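/- There are absolute constants $c>0$ and $n_0$ such that the following holds for all integers $n\ge n_0$ and $v\ge 1$ and every finite universe $\mathcal U$ with $|\mathcal U|\ge n^3$. An incremental retrieval data structure with capacity $n$ maintains, starting from the empty key set, a set $K\subseteq\mathcal U$ of at most $n$ keys together with a $v$-bit value $f(k)$ for each $k\in K$, under insertions of a new key with a value (allowed while $|K|<n$) and updates of the value of a key in $K$; a query for a key $k$ must return $f(k)$ if $k\in K$, and may return anything if $k\notin K$. Its memory content is a finite bit string; it may be randomized, random bits are not charged to its size, and its answers are correct with probability $1$. Let $S$ be its expected size in bits, that is, the supremum over all legal sequences of operations of the expected length of the memory content after the sequence. Then $$S\;\ge\; nv + c\,n + c\,n\cdot\max\Bigl\{\log_2\Bigl(\frac{\log_2 n}{v}\Bigr),\,0\Bigr\}.$$ In other words, any incremental retrieval data structure over a universe of size at least $n^3$ has expected size $S\ge nv+\Omega(n)+\Omega\bigl(n\log\frac{\log n}{v}\bigr)$. -/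

import Mathlib

open MeasureTheory
open scoped ENNReal

namespace Retrieval

/-- A `v`-bit value. -/
abbrev Value (v : ℕ) : Type := Fin v → Bool

/-- A partial assignment of `v`-bit values to keys: `f k = some x` means that `k` belongs to the
current key set and has value `x`, and `f k = none` that `k` is not in the current key set. -/
abbrev Table (U : Type*) (v : ℕ) := U → Option (Value v)

/-- The empty key set. -/
def Table.empty (U : Type*) (v : ℕ) : Table U v := fun _ => none

/-- The number of keys in the current key set. -/
def Table.numKeys {U : Type*} [Fintype U] {v : ℕ} (f : Table U v) : ℕ :=
  (Finset.univ.filter fun k : U => (f k).isSome = true).card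

/-- The operations of the incremental setting that change the stored assignment. -/
inductive Op (U : Type*) (v : ℕ) where
  | insert (k : U) (x : Value v)
  | update (k : U) (x : Value v)

/-- The effect of an operation on the assignment. -/
def Op.apply {U : Type*} [DecidableEq U] {v : ℕ} (f : Table U v) : Op U v → Table U v
  | .insert k x => Function.update f k (some x)
  | .update k x => Function.update f k (some x)

/-- An insertion is allowed for a new key, as long as fewer than `n` keys are present; an update is
allowed for a key that is present. -/
def Op.Legal {U : Type*} [Fintype U] {v : ℕ} (n : ℕ) (f : Table U v) : Op U v → Prop
  | .insert k _ => f k = none ∧ f.numKeys < n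
  | .update k _ => f k ≠ none

/-- The assignment after a sequence of operations, starting from the assignment `f`. -/
def Table.after {U : Type*} [DecidableEq U] {v : ℕ} (f : Table U v) (ops : List (Op U v)) :
    Table U v :=
  ops.foldl Op.apply f

/-- Every operation of the sequence, performed in order from the assignment `f`, is allowed. -/
def LegalFrom {U : Type*} [Fintype U] [DecidableEq U] {v : ℕ} (n : ℕ) :
    Table U v → List (Op U v) → Prop
  | _, [] => True
  | f, o :: ops => o.Legal n f ∧ LegalFrom n (o.apply f) ops

/-- A sequence of operations is legal (for capacity `n`) if each of them is allowed when the
sequence is performed in order from the empty key set. -/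
def Legal {U : Type*} [Fintype U] [DecidableEq U] {v : ℕ} (n : ℕ) (ops : List (Op U v)) : Prop :=
  LegalFrom n (Table.empty U v) ops

/-- A randomized program with the interface of an incremental retrieval data structure. The memory
content is a finite bit string. Every procedure may read the random source `ω : Ω`, which is not
charged for. The argument of type `ℕ` is the number of insertions and updates performed before, so
that an operation may use random bits that are independent of those used by earlier ones. The
program is not restricted in any other way; in particular its procedures need not be computable. -/
structure Program (U : Type*) (v : ℕ) (Ω : Type*) where
  init : Ω → List Bool
  insert : Ω → ℕ → List Bool → U → Value v → List Bool
  update : Ω → ℕ → List Bool → U → Value v → List Bool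
  query : Ω → ℕ → List Bool → U → Value v

namespace Program

variable {U : Type*} {v : ℕ} {Ω : Type*}

/-- One operation on the memory `σ`, when `t` operations have been performed before. -/
def step (D : Program U v Ω) (ω : Ω) (t : ℕ) (σ : List Bool) : Op U v → List Bool
  | .insert k x => D.insert ω t σ k x
  | .update k x => D.update ω t σ k x

/-- The memory after the given operations, from the memory `σ` that was reached by `t`
operations. -/
def runFrom (D : Program U v Ω) (ω : Ω) : ℕ → List Bool → List (Op U v) → List Bool
  | _, σ, [] => σ
  | t, σ, o :: ops => D.runFrom ω (t + 1) (D.step ω t σ o) ops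

/-- The memory after the given operations, from the initial memory. -/
def run (D : Program U v Ω) (ω : Ω) (ops : List (Op U v)) : List Bool :=
  D.runFrom ω 0 (D.init ω) ops

/-- The number of bits of memory in use after the given operations. -/
def size (D : Program U v Ω) (ω : Ω) (ops : List (Op U v)) : ℕ :=
  (D.run ω ops).length

end Program

/-- A (randomized) incremental retrieval data structure with capacity `n` for `v`-bit values on keys
from the universe `U`: after any legal sequence of insertions and updates (fixed independently of
the random source), almost surely every key in the current key set is queried correctly; nothing is
asked about the answers for other keys. Queries do not change the memory. -/
structure IncrementalRetrieval (U : Type*) [Fintype U] [DecidableEq U] (n v : ℕ)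
    {Ω : Type*} [MeasurableSpace Ω] (P : Measure Ω) extends Program U v Ω where
  measurable_size : ∀ ops : List (Op U v), Legal n ops →
    Measurable fun ω => toProgram.size ω ops
  correct : ∀ ops : List (Op U v), Legal n ops → ∀ᵐ ω ∂P, ∀ (k : U) (x : Value v),
    (Table.empty U v).after ops k = some x →
      query ω ops.length (toProgram.run ω ops) k = x

/-- The expected size of the data structure, in bits: the supremum, over all legal sequences of
operations, of the expectation of the size of the memory after the sequence. -/
noncomputable def IncrementalRetrieval.expectedSize {U : Type*} [Fintype U] [DecidableEq U]
    {n v : ℕ} {Ω : Type*} [MeasurableSpace Ω] {P : Measure Ω}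
    (D : IncrementalRetrieval U n v P) : ℝ≥0∞ :=
  ⨆ (ops : List (Op U v)) (_ : Legal n ops), ∫⁻ ω, (D.size ω ops : ℝ≥0∞) ∂P

end Retrieval

/-!
Take keys from a grid `Fin p × Fin r × Fin n` with `p + r = n`, which embeds into the universe
because `p * r * n ≤ n ^ 3`. One batch of `p` random keys contains one key of each row, another
batch of `r` random keys contains one key of each column; the two batches share a key with
probability at most `1 / n`. All values are uniform. By `exists_correct_outcome` the random source
can be fixed, so that the memory becomes a function of the operations.

Entropy is replaced by weights. Memory `m` gets the weight `exp (-codeLen N m)`, and these weights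
sum to at most one (`sum_exp_neg_codeLen_le`), while the mean of `codeLen N` exceeds `N log 2` by at
most about twice the excess of the mean length over `N` (`sum_codeLen_le`). A bound on a sum of
weights `exp (g x)` over all inputs bounds the mean of `g` (`sum_le_of_sum_exp_le`), so every
encoding argument is a summation over the memories and keys that an input is recovered from.

*Linear redundancy* (`update_tradeoff`). Insert both batches, and then give new values to the column
batch; let `D` be the set of keys whose answer changes. Since the second memory depends only on the
first one and on the column batch, `D` is disjoint from every row batch that is compatible with
both. If the redundancy is small, the first memory says little about the row batch, so that `D` is
sparse (`mul_sum_density_differ_le`). But on average `D` contains at least half of the column batch,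
so the two memories reveal a constant number of bits about each of these keys. Given the row batch and
its values, the second memory has to hold this information besides the new values, and
comparing lengths gives a redundancy proportional to `n`.

*Logarithmic redundancy* (`insertion_tradeoff`). Insert the row batch, and then the column batch with
`r` about `n / (2 * v)`, so that the first memory has only `n / 2` spare bits besides the redundancy.
The first memory therefore cannot exclude many keys: the set `X` of keys that occur in some
row batch leading to it has density at least about `(log₂ n / v) ^ (-1/4)`
(`exp_mul_card_le_sum_density`). An answer for a key of `X` must survive the second batch, unless
that batch meets the row batch witnessing membership in `X`, which is rare
(`sum_density_changedKeys_le`). Hence the keys of `X` whose answer changes are sparse, and they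
include on average at least half of the inserted keys that lie in `X`. The second memory thus holds
about `(log₂ n) / 2` bits of information on each of these, in addition to all `n * v` bits of values.
-/

namespace Retrieval

/-! ### Counting and coding tools -/

/-- Gibbs' inequality in the form used for all encoding arguments: if the mean of `exp g` is at
most `exp c`, then the mean of `g` is at most `c`. -/
theorem sum_le_of_sum_exp_le {ι : Type*} (s : Finset ι) (g : ι → ℝ) (c : ℝ)
    (h : ∑ x ∈ s, Real.exp (g x) ≤ s.card * Real.exp c) : ∑ x ∈ s, g x ≤ s.card * c := by
  have h1 : ∑ x ∈ s, (g x - c + 1) ≤ ∑ x ∈ s, Real.exp (g x - c) :=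
    Finset.sum_le_sum fun x _ => Real.add_one_le_exp _
  have h2 : ∑ x ∈ s, Real.exp (g x - c) ≤ s.card := by
    simp_rw [Real.exp_sub, ← Finset.sum_div]
    rwa [div_le_iff₀ (Real.exp_pos c)]
  simp only [Finset.sum_add_distrib, Finset.sum_sub_distrib, Finset.sum_const, nsmul_eq_mul,
    mul_one] at h1
  linarith

theorem sum_comp_le_of_injOn {ι κ : Type*} [DecidableEq κ] {s : Finset ι} {t : Finset κ}
    (e : ι → κ) (f : κ → ℝ) (hst : ∀ x ∈ s, e x ∈ t) (he : Set.InjOn e s)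
    (hf : ∀ y ∈ t, 0 ≤ f y) : ∑ x ∈ s, f (e x) ≤ ∑ y ∈ t, f y := by
  rw [← Finset.sum_image he]
  exact Finset.sum_le_sum_of_subset_of_nonneg (Finset.image_subset_iff.2 hst)
    fun y hy _ => hf y hy

/-- One coordinate of a uniformly random function is uniform. -/
theorem sum_apply_mul_card {ι β : Type*} [Fintype ι] [DecidableEq ι] [Fintype β] (j : ι)
    (f : β → ℝ) :
    (∑ b : ι → β, f (b j)) * Fintype.card β = Fintype.card (ι → β) * ∑ c, f c := by
  have h1 : ∑ b : ι → β, f (b j) = Fintype.card ({i // i ≠ j} → β) * ∑ c, f c := by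
    rw [Fintype.sum_equiv (Equiv.funSplitAt j β) (fun b => f (b j)) (fun y => f y.1)
      (fun b => rfl), Fintype.sum_prod_type]
    simp [Finset.mul_sum]
  rw [h1, Fintype.card_congr (Equiv.funSplitAt j β), Fintype.card_prod]
  push_cast
  ring

theorem card_filter_length_le (F : Finset (List Bool)) (l : ℕ) :
    (F.filter fun m => m.length = l).card ≤ 2 ^ l := by
  have h : F.filter (fun m => m.length = l) ⊆
      (Finset.univ : Finset (Fin l → Bool)).image List.ofFn := by
    intro m hm
    obtain rfl := (Finset.mem_filter.1 hm).2
    exact Finset.mem_image.2 ⟨m.get, Finset.mem_univ _, List.ofFn_get m⟩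
  refine (Finset.card_le_card h).trans (Finset.card_image_le.trans ?_)
  simp

theorem sum_length_le (F : Finset (List Bool)) (f : ℕ → ℝ) (hf : ∀ l, 0 ≤ f l) :
    ∃ L, ∑ m ∈ F, f m.length ≤ ∑ l ∈ Finset.range L, 2 ^ l * f l := by
  refine ⟨F.sup List.length + 1, ?_⟩
  rw [← Finset.sum_fiberwise_of_maps_to (g := List.length)
    (t := Finset.range (F.sup List.length + 1))
    (fun m hm => Finset.mem_range.2 (Nat.lt_succ_of_le (Finset.le_sup (f := List.length) hm)))]
  refine Finset.sum_le_sum fun l _ => ?_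
  rw [Finset.sum_congr rfl (g := fun _ => f l) (fun m hm => by rw [(Finset.mem_filter.1 hm).2]),
    Finset.sum_const, nsmul_eq_mul]
  exact mul_le_mul_of_nonneg_right (by exact_mod_cast card_filter_length_le F l) (hf l)

/-- The length, in nats, of a prefix code for bit strings that is tailored to strings of about `N`
bits. Strings of fewer than `N` bits cost `N` bits, and bits beyond the `N`-th cost two bits each.
The overhead is a constant that does not depend on `N`, which matters because `N` may be
arbitrarily large compared with the number of keys. -/
noncomputable def codeLen (N : ℕ) (m : List Bool) : ℝ :=
  Real.log 2 * (N + 2 * ((m.length - N : ℕ) : ℝ)) + Real.log 3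

/-- Kraft's inequality for `codeLen`. -/
theorem sum_exp_neg_codeLen_le (N : ℕ) (F : Finset (List Bool)) :
    ∑ m ∈ F, Real.exp (-codeLen N m) ≤ 1 := by
  have hexp : ∀ l : ℕ, Real.exp (-(Real.log 2 * (N + 2 * ((l - N : ℕ) : ℝ)) + Real.log 3)) =
      (1 / 2) ^ (N + 2 * (l - N)) / 3 := by
    intro l
    rw [neg_add, Real.exp_add, Real.exp_neg (Real.log 3), Real.exp_log (by norm_num),
      Real.exp_neg, Real.exp_mul, Real.exp_log (by norm_num)]
    rw [show ((N : ℝ) + 2 * ((l - N : ℕ) : ℝ)) = ((N + 2 * (l - N) : ℕ) : ℝ) by push_cast; ring,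
      Real.rpow_natCast]
    simp [div_eq_mul_inv]
  obtain ⟨L, hL⟩ := sum_length_le F
    (fun l => Real.exp (-(Real.log 2 * (N + 2 * ((l - N : ℕ) : ℝ)) + Real.log 3)))
    (fun l => (Real.exp_pos _).le)
  refine hL.trans ?_
  have key : ∀ L : ℕ, ∑ l ∈ Finset.range L, (2 : ℝ) ^ l * ((1 / 2) ^ (N + 2 * (l - N)) / 3) ≤
      if L ≤ N then (1 / 2) ^ (N - L) / 3 else 1 - 2 * (1 / 2) ^ (L - N) / 3 := by
    intro L
    induction L with
    | zero => simp; positivity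
    | succ L ih =>
      rw [Finset.sum_range_succ]
      rcases lt_trichotomy L N with h | h | h
      · rw [if_pos h.le] at ih
        rw [if_pos (by omega)]
        obtain ⟨k, rfl⟩ := Nat.exists_eq_add_of_lt h
        have hterm : (2 : ℝ) ^ L * ((1 / 2) ^ (L + k + 1 + 2 * (L - (L + k + 1))) / 3) =
            (1 / 2) ^ (k + 1) / 3 := by
          rw [show L + k + 1 + 2 * (L - (L + k + 1)) = L + (k + 1) by omega, pow_add,
            show (2 : ℝ) ^ L * ((1 / 2) ^ L * (1 / 2) ^ (k + 1) / 3) =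
              (2 * (1 / 2)) ^ L * (1 / 2) ^ (k + 1) / 3 by rw [mul_pow]; ring]
          norm_num
        rw [show L + k + 1 - L = k + 1 by omega] at ih
        rw [hterm, show L + k + 1 - (L + 1) = k by omega]
        have hk : (1 / 2 : ℝ) ^ (k + 1) = (1 / 2) ^ k / 2 := by rw [pow_succ]; ring
        linarith
      · subst h
        rw [if_pos le_rfl] at ih
        rw [if_neg (by omega)]
        simp only [Nat.sub_self, mul_zero, add_zero, pow_zero, Nat.add_sub_cancel_left,
          pow_one] at *
        rw [show (2 : ℝ) ^ L * ((1 / 2) ^ L / 3) = (2 * (1 / 2)) ^ L / 3 by rw [mul_pow]; ring]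
        norm_num at *
        linarith
      · rw [if_neg (by omega)] at ih
        rw [if_neg (by omega)]
        obtain ⟨k, rfl⟩ := Nat.exists_eq_add_of_lt h
        rw [show N + k + 1 - N = k + 1 by omega] at *
        rw [show N + k + 1 + 1 - N = k + 2 by omega,
          show N + 2 * (k + 1) = (N + k + 1) + (k + 1) by ring, pow_add (1 / 2 : ℝ) (N + k + 1),
          show (2 : ℝ) ^ (N + k + 1) * ((1 / 2) ^ (N + k + 1) * (1 / 2) ^ (k + 1) / 3) =
            (2 * (1 / 2)) ^ (N + k + 1) * (1 / 2) ^ (k + 1) / 3 by rw [mul_pow]; ring]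
        rw [pow_succ (1 / 2 : ℝ) (k + 1)]
        norm_num at *
        linarith
  refine (Finset.sum_congr rfl fun l _ => by rw [hexp]).trans_le ((key L).trans ?_)
  split_ifs with h
  · have : (1 / 2 : ℝ) ^ (N - L) ≤ 1 := pow_le_one₀ (by norm_num) (by norm_num)
    linarith
  · have : (0 : ℝ) ≤ (1 / 2) ^ (L - N) := by positivity
    linarith

/-- Distinct strings are rarely much shorter than `N` bits, compared with a family of `2 ^ N`. -/
theorem sum_sub_length_le (N : ℕ) (F : Finset (List Bool)) :
    ∑ m ∈ F, ((N - m.length : ℕ) : ℝ) ≤ 2 * 2 ^ N := by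
  obtain ⟨L, hL⟩ := sum_length_le F (fun l => ((N - l : ℕ) : ℝ)) (fun l => Nat.cast_nonneg _)
  refine hL.trans ?_
  have key : ∀ L : ℕ, ∑ l ∈ Finset.range L, (2 : ℝ) ^ l * ((N - l : ℕ) : ℝ) ≤
      if L ≤ N then 2 ^ L * (((N - L : ℕ) : ℝ) + 2) else 2 * 2 ^ N := by
    intro L
    induction L with
    | zero => simp; positivity
    | succ L ih =>
      rw [Finset.sum_range_succ]
      rcases lt_trichotomy L N with h | h | h
      · rw [if_pos h.le] at ih
        rw [if_pos (by omega)]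
        have hk : ((N - L : ℕ) : ℝ) = ((N - (L + 1) : ℕ) : ℝ) + 1 := by
          exact_mod_cast (by omega : N - L = N - (L + 1) + 1)
        rw [hk] at ih ⊢
        rw [pow_succ]
        linarith
      · subst h
        rw [if_pos le_rfl] at ih
        rw [if_neg (by omega)]
        simp only [Nat.sub_self, Nat.cast_zero, mul_zero, add_zero, zero_add] at *
        linarith
      · rw [if_neg (by omega)] at ih
        rw [if_neg (by omega), Nat.sub_eq_zero_of_le h.le]
        simpa using ih
  refine (key L).trans ?_
  split_ifs with h
  · obtain ⟨k, rfl⟩ := Nat.exists_eq_add_of_le h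
    have hk : ((k : ℕ) : ℝ) + 1 ≤ 2 ^ k := by exact_mod_cast Nat.lt_two_pow_self (n := k)
    have h1 : (1 : ℝ) ≤ 2 ^ k := one_le_pow₀ (by norm_num)
    rw [Nat.add_sub_cancel_left, pow_add, show 2 * ((2 : ℝ) ^ L * 2 ^ k) = 2 ^ L * (2 * 2 ^ k) by
      ring]
    gcongr
    linarith
  · exact le_rfl

theorem codeLen_eq (N : ℕ) (m : List Bool) :
    codeLen N m = N * Real.log 2 + (2 * Real.log 2 * ((m.length : ℝ) - N) +
      (2 * Real.log 2 * ((N - m.length : ℕ) : ℝ) + Real.log 3)) := by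
  unfold codeLen
  rcases le_total N m.length with h | h
  · rw [Nat.sub_eq_zero_of_le h, Nat.cast_sub h]; push_cast; ring
  · rw [Nat.sub_eq_zero_of_le h, Nat.cast_sub h]; push_cast; ring

/-- If the mean of the shortfall of the memories `m x` from `N` bits, truncated at zero, is at most two,
then the mean code length exceeds `N log 2` by at most about twice the number of bits by which the
mean length exceeds `N`. -/
theorem sum_codeLen_le {ι : Type*} (s : Finset ι) (m : ι → List Bool) (N : ℕ) (A : ℝ)
    (hshort : ∑ x ∈ s, ((N - (m x).length : ℕ) : ℝ) ≤ 2 * s.card)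
    (hA : ∑ x ∈ s, ((m x).length : ℝ) ≤ A * s.card) :
    ∑ x ∈ s, codeLen N (m x) ≤
      (N * Real.log 2 + (2 * Real.log 2 * (A - N) + 4)) * s.card := by
  have hl : 0 < Real.log 2 := Real.log_pos (by norm_num)
  have h24 : 4 * Real.log 2 + Real.log 3 ≤ 4 := by
    have : 4 * Real.log 2 + Real.log 3 = Real.log 48 := by
      rw [show (48 : ℝ) = 2 ^ 4 * 3 by norm_num, Real.log_mul (by norm_num) (by norm_num),
        Real.log_pow]
      norm_num
    rw [this, Real.log_le_iff_le_exp (by norm_num)]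
    have h1 := Real.exp_one_gt_d9
    have : Real.exp 4 = Real.exp 1 ^ 4 := by rw [← Real.exp_nat_mul]; norm_num
    rw [this]
    calc (48 : ℝ) ≤ 2.7 ^ 4 := by norm_num
      _ ≤ _ := by gcongr; linarith
  simp_rw [codeLen_eq, Finset.sum_add_distrib, ← Finset.mul_sum, Finset.sum_sub_distrib,
    Finset.sum_const, nsmul_eq_mul]
  have h1 := mul_le_mul_of_nonneg_left hshort (by positivity : 0 ≤ 2 * Real.log 2)
  have h2 := mul_le_mul_of_nonneg_left hA (by positivity : 0 ≤ 2 * Real.log 2)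
  have h3 := mul_le_mul_of_nonneg_right h24 (Nat.cast_nonneg s.card : (0 : ℝ) ≤ s.card)
  nlinarith [h1, h2, h3]

/-! ### Transversals of a grid of keys -/

/-- The grid of keys; the first coordinate is the row, the second the column, and there are `s`
keys in each cell. -/
abbrev Point (p r s : ℕ) : Type := Fin p × Fin r × Fin s

/-- A choice of one key in each row, given by its column and its position in the cell. -/
abbrev RowKeys (p r s : ℕ) : Type := Fin p → Fin r × Fin s

/-- A choice of one key in each column, given by its row and its position in the cell. -/
abbrev ColKeys (p r s : ℕ) : Type := Fin r → Fin p × Fin s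

section

variable {p r s v : ℕ}

/-- The chosen key of row `i`. -/
def RowKeys.key (a : RowKeys p r s) (i : Fin p) : Point p r s := (i, a i)

/-- The chosen key of column `j`. -/
def ColKeys.key (b : ColKeys p r s) (j : Fin r) : Point p r s := ((b j).1, j, (b j).2)

/-- The two transversals have a key in common. -/
def Meets (a : RowKeys p r s) (b : ColKeys p r s) : Prop := ∃ i, b (a i).1 = (i, (a i).2)

instance (a : RowKeys p r s) (b : ColKeys p r s) : Decidable (Meets a b) :=
  inferInstanceAs (Decidable (∃ i, b (a i).1 = (i, (a i).2)))

theorem RowKeys.key_ne_key {a : RowKeys p r s} {b : ColKeys p r s} (h : ¬ Meets a b) (i : Fin p)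
    (j : Fin r) : a.key i ≠ b.key j := by
  intro he
  apply h
  simp only [RowKeys.key, ColKeys.key, Prod.mk.injEq] at he
  refine ⟨i, ?_⟩
  obtain ⟨h1, h2⟩ := he
  rw [h2, h1]

theorem RowKeys.key_injective (a : RowKeys p r s) : Function.Injective a.key :=
  fun _ _ h => (Prod.mk.inj h).1

theorem ColKeys.key_injective (b : ColKeys p r s) : Function.Injective b.key :=
  fun _ _ h => (Prod.mk.inj (Prod.mk.inj h).2).1

theorem card_rowKeys : (Fintype.card (RowKeys p r s) : ℝ) = ((r : ℝ) * s) ^ p := by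
  simp

theorem card_colKeys : (Fintype.card (ColKeys p r s) : ℝ) = ((p : ℝ) * s) ^ r := by
  simp

/-- A random column transversal meets a given row transversal with probability at most `1 / s`, by
a union bound over the rows. -/
theorem card_meets_mul_le (hs : 0 < s) (a : RowKeys p r s) :
    ((Finset.univ.filter fun b => Meets a b).card : ℝ) * s ≤ Fintype.card (ColKeys p r s) := by
  rcases Nat.eq_zero_or_pos p with rfl | hp
  · have : (Finset.univ.filter fun b => Meets a b) = ∅ := by
      ext b; simp [Meets]
    rw [this]; simp
  have hfix : ∀ i, ((Finset.univ.filter fun b : ColKeys p r s =>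
      b (a i).1 = (i, (a i).2)).card : ℝ) * (p * s) = Fintype.card (ColKeys p r s) := by
    intro i
    have := sum_apply_mul_card (ι := Fin r) (β := Fin p × Fin s) (a i).1
      (fun c => if c = (i, (a i).2) then 1 else 0)
    simpa [Finset.sum_boole] using this
  have hle : ((Finset.univ.filter fun b => Meets a b).card : ℝ) ≤
      ∑ i, ((Finset.univ.filter fun b : ColKeys p r s => b (a i).1 = (i, (a i).2)).card : ℝ) := by
    have : (Finset.univ.filter fun b => Meets a b) ⊆ Finset.univ.biUnion fun i =>
        Finset.univ.filter fun b : ColKeys p r s => b (a i).1 = (i, (a i).2) := by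
      intro b hb
      obtain ⟨i, hi⟩ := (Finset.mem_filter.1 hb).2
      exact Finset.mem_biUnion.2 ⟨i, Finset.mem_univ _, Finset.mem_filter.2 ⟨Finset.mem_univ _, hi⟩⟩
    exact_mod_cast (Finset.card_le_card this).trans Finset.card_biUnion_le
  have hp' : (0 : ℝ) < p := by exact_mod_cast hp
  refine le_of_mul_le_mul_right (a := (p : ℝ)) ?_ hp'
  calc _ ≤ (∑ i, ((Finset.univ.filter fun b : ColKeys p r s =>
        b (a i).1 = (i, (a i).2)).card : ℝ)) * s * p := by gcongr
    _ = ∑ i : Fin p, (Fintype.card (ColKeys p r s) : ℝ) := by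
      rw [mul_assoc, mul_comm (s : ℝ), Finset.sum_mul]
      exact Finset.sum_congr rfl fun i _ => hfix i
    _ = _ := by simp; ring

/-- The proportion of the grid that is covered by `X`. -/
noncomputable def density (X : Finset (Point p r s)) : ℝ := X.card / (p * (r * s))

theorem density_nonneg (X : Finset (Point p r s)) : 0 ≤ density X := by
  unfold density; positivity

theorem card_eq_sum_rows (X : Finset (Point p r s)) :
    X.card = ∑ i, (Finset.univ.filter fun c => (i, c) ∈ X).card := by
  rw [Finset.card_eq_sum_card_fiberwise (f := Prod.fst) (t := Finset.univ) (by simp)]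
  refine Finset.sum_congr rfl fun i _ => ?_
  refine Finset.card_bij' (fun x _ => x.2) (fun c _ => (i, c)) ?_ ?_ ?_ ?_
  · rintro ⟨i', c⟩ h
    obtain ⟨h1, rfl⟩ := Finset.mem_filter.1 h
    simpa using h1
  · intro c h; simpa using h
  · rintro ⟨i', c⟩ h
    obtain ⟨h1, rfl⟩ := Finset.mem_filter.1 h
    rfl
  · intro c h; rfl

theorem card_eq_sum_cols (X : Finset (Point p r s)) :
    X.card = ∑ j, (Finset.univ.filter fun c : Fin p × Fin s => (c.1, j, c.2) ∈ X).card := by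
  rw [Finset.card_eq_sum_card_fiberwise (f := fun x => x.2.1) (t := Finset.univ) (by simp)]
  refine Finset.sum_congr rfl fun j _ => ?_
  refine Finset.card_bij' (fun x _ => (x.1, x.2.2)) (fun c _ => (c.1, j, c.2)) ?_ ?_ ?_ ?_
  · rintro ⟨i, j', c⟩ h
    obtain ⟨h1, rfl⟩ := Finset.mem_filter.1 h
    simpa using h1
  · intro c h; simpa using h
  · rintro ⟨i, j', c⟩ h
    obtain ⟨h1, rfl⟩ := Finset.mem_filter.1 h
    rfl
  · intro c h; rfl

/-- The number of row transversals inside `X`. The bound is linear in the density on the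
logarithmic scale, with a free parameter `θ`; for `θ = density X` it is the inequality of the
arithmetic and geometric means of the densities of the rows. -/
theorem card_rowKeys_subset_le (hp : 0 < p) (hr : 0 < r) (hs : 0 < s) (X : Finset (Point p r s))
    {θ : ℝ} (hθ : 0 < θ) :
    ((Finset.univ.filter fun a : RowKeys p r s => ∀ i, a.key i ∈ X).card : ℝ) ≤
      ((r : ℝ) * s) ^ p * (θ ^ p * Real.exp (p * (density X / θ - 1))) := by
  have hcard : (Finset.univ.filter fun a : RowKeys p r s => ∀ i, a.key i ∈ X).card =
      ∏ i, (Finset.univ.filter fun c => (i, c) ∈ X).card := by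
    rw [← Fintype.card_piFinset]
    congr 1
    ext a
    simp only [Finset.mem_filter, Finset.mem_univ, true_and, Fintype.mem_piFinset]
    rfl
  have hp' : (0 : ℝ) < p := by exact_mod_cast hp
  have hr' : (0 : ℝ) < r := by exact_mod_cast hr
  have hs' : (0 : ℝ) < s := by exact_mod_cast hs
  have hi : ∀ i, ((Finset.univ.filter fun c => (i, c) ∈ X).card : ℝ) ≤ ((r : ℝ) * s) * (θ *
      Real.exp (((Finset.univ.filter fun c => (i, c) ∈ X).card : ℝ) / (r * s * θ) - 1)) := by
    intro i
    set y : ℝ := ((Finset.univ.filter fun c => (i, c) ∈ X).card : ℝ)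
    -- `u ≤ exp (u - 1)` with `u` the quotient of the density of the row and `θ`.
    have := Real.add_one_le_exp (y / (r * s * θ) - 1)
    calc y = (r * s) * (θ * (y / (r * s * θ))) := by field_simp
      _ ≤ _ := by gcongr; linarith
  rw [hcard]
  push_cast
  refine (Finset.prod_le_prod (fun i _ => Nat.cast_nonneg _) fun i _ => hi i).trans (le_of_eq ?_)
  rw [Finset.prod_mul_distrib (f := fun _ => (r : ℝ) * s), Finset.prod_mul_distrib (f := fun _ => θ),
    ← Real.exp_sum, Finset.sum_sub_distrib, ← Finset.sum_div, density, card_eq_sum_rows]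
  simp only [Finset.prod_const, Finset.card_univ, Fintype.card_fin, Finset.sum_const,
    nsmul_eq_mul, mul_one]
  push_cast
  congr 3
  field_simp

/-- The number of keys of the column transversal `b` that lie in `D`. -/
def hits (b : ColKeys p r s) (D : Finset (Point p r s)) : ℕ :=
  (Finset.univ.filter fun j => b.key j ∈ D).card

/-- The exponential moment of the number of hits, normalized: it serves as the code of a column
transversal that gains `log t` for every key that lies in the known sparse set `D`. -/
theorem sum_exp_hits_le (hp : 0 < p) (hr : 0 < r) (hs : 0 < s) (D : Finset (Point p r s)) {t : ℝ}
    (ht : 1 ≤ t) :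
    ∑ b : ColKeys p r s, Real.exp (hits b D * Real.log t - (t - 1) * r * density D) ≤
      Fintype.card (ColKeys p r s) := by
  have ht0 : 0 < t := by linarith
  have hp' : (0 : ℝ) < p := by exact_mod_cast hp
  have hr' : (0 : ℝ) < r := by exact_mod_cast hr
  have hs' : (0 : ℝ) < s := by exact_mod_cast hs
  have hprod : ∀ b : ColKeys p r s, Real.exp (hits b D * Real.log t) =
      ∏ j, if ((b j).1, j, (b j).2) ∈ D then t else 1 := by
    intro b
    rw [Finset.prod_ite]
    simp only [Finset.prod_const, one_pow, mul_one]
    rw [Real.exp_nat_mul, Real.exp_log ht0]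
    rfl
  simp_rw [Real.exp_sub, ← Finset.sum_div, hprod]
  rw [div_le_iff₀ (Real.exp_pos _), card_colKeys]
  have hsum := Finset.prod_univ_sum (fun _ : Fin r => (Finset.univ : Finset (Fin p × Fin s)))
    (fun j c => if (c.1, j, c.2) ∈ D then t else 1)
  rw [Fintype.piFinset_univ] at hsum
  rw [← hsum]
  have hj : ∀ j, ∑ c : Fin p × Fin s, (if (c.1, j, c.2) ∈ D then t else 1) ≤ (p * s : ℝ) *
      Real.exp ((t - 1) * ((Finset.univ.filter fun c : Fin p × Fin s =>
        (c.1, j, c.2) ∈ D).card : ℝ) / (p * s)) := by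
    intro j
    set y : ℝ := ((Finset.univ.filter fun c : Fin p × Fin s => (c.1, j, c.2) ∈ D).card : ℝ)
      with hy
    have h1 : ∑ c : Fin p × Fin s, (if (c.1, j, c.2) ∈ D then t else 1) =
        p * s + (t - 1) * y := by
      have : ∀ c : Fin p × Fin s, (if (c.1, j, c.2) ∈ D then t else 1) =
          1 + (t - 1) * (if (c.1, j, c.2) ∈ D then 1 else 0) := by
        intro c; split_ifs <;> ring
      simp_rw [this]
      rw [Finset.sum_add_distrib, ← Finset.mul_sum, Finset.sum_boole]
      simp [hy]
    rw [h1]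
    have := Real.add_one_le_exp ((t - 1) * y / (p * s))
    calc (p : ℝ) * s + (t - 1) * y = p * s * ((t - 1) * y / (p * s) + 1) := by field_simp; ring
      _ ≤ _ := by gcongr
  refine (Finset.prod_le_prod (fun j _ => Finset.sum_nonneg fun c _ => by split_ifs <;> linarith)
    fun j _ => hj j).trans (le_of_eq ?_)
  rw [Finset.prod_mul_distrib, ← Real.exp_sum, ← Finset.sum_div, ← Finset.mul_sum, density,
    card_eq_sum_cols]
  simp only [Finset.prod_const, Finset.card_univ, Fintype.card_fin]
  push_cast
  congr 2
  field_simp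

theorem card_value : Fintype.card (Value v) = 2 ^ v := by simp

theorem half_le_sum_ne (hv : 1 ≤ v) (w : Value v) :
    (Fintype.card (Value v) : ℝ) / 2 ≤ ∑ c : Value v, if c ≠ w then (1 : ℝ) else 0 := by
  rw [Finset.sum_boole, Finset.filter_ne', Finset.card_erase_of_mem (Finset.mem_univ _),
    Finset.card_univ, card_value, Nat.cast_sub Nat.one_le_two_pow]
  have : (2 : ℝ) ^ 1 ≤ 2 ^ v := pow_le_pow_right₀ (by norm_num) hv
  push_cast
  linarith

/-- Independent uniform values differ from prescribed ones in at least half of any given set of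
positions on average. -/
theorem half_mul_card_le_sum_ne {ι : Type*} [Fintype ι] [DecidableEq ι] (hv : 1 ≤ v)
    (w : ι → Value v) (J : Finset ι) :
    (Fintype.card (ι → Value v) : ℝ) * (J.card / 2) ≤
      ∑ V : ι → Value v, ((J.filter fun j => V j ≠ w j).card : ℝ) := by
  have h2 : (0 : ℝ) < Fintype.card (Value v) := by exact_mod_cast Fintype.card_pos
  have hj : ∀ j, (Fintype.card (ι → Value v) : ℝ) / 2 ≤
      ∑ V : ι → Value v, if V j ≠ w j then (1 : ℝ) else 0 := by
    intro j
    have h := sum_apply_mul_card (ι := ι) j (fun c => if c ≠ w j then (1 : ℝ) else 0)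
    refine le_of_mul_le_mul_right (a := (Fintype.card (Value v) : ℝ)) ?_ h2
    rw [h]
    have := mul_le_mul_of_nonneg_left (half_le_sum_ne hv (w j))
      (Nat.cast_nonneg (Fintype.card (ι → Value v)) : (0 : ℝ) ≤ _)
    linarith
  simp_rw [Finset.card_filter]
  push_cast
  rw [Finset.sum_comm]
  calc _ = ∑ j ∈ J, (Fintype.card (ι → Value v) : ℝ) / 2 := by simp; ring
    _ ≤ _ := Finset.sum_le_sum fun j _ => hj j

end

section Tradeoffs

variable {p r s v : ℕ}

/-! ### Insertions: the keys that the first memory cannot exclude -/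

open Classical in
/-- The keys of all row transversals that lead, with some values, to the memory `m`. -/
noncomputable def possibleKeys (M₀ : RowKeys p r s → (Fin p → Value v) → List Bool)
    (m : List Bool) : Finset (Point p r s) :=
  Finset.univ.filter fun x => ∃ a V, M₀ a V = m ∧ ∃ i, a.key i = x

theorem card_vals (ι : Type*) [Fintype ι] [DecidableEq ι] :
    (Fintype.card (ι → Value v) : ℝ) = Real.exp (Fintype.card ι * v * Real.log 2) := by
  rw [Fintype.card_fun, card_value, ← pow_mul, Nat.cast_pow, mul_comm v, ← Nat.cast_mul,
    Real.exp_nat_mul, Real.exp_log] <;> norm_num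

/-- A memory with at most `E` nats of redundancy leaves, on average, a proportion `exp (-E / p)` of
the grid possible: the row transversal lies in the set of possible keys and, together with the
memory, determines the values. -/
theorem exp_mul_card_le_sum_density (hp : 0 < p) (hr : 0 < r) (hs : 0 < s)
    (M₀ : RowKeys p r s → (Fin p → Value v) → List Bool)
    (ans₀ : List Bool → Point p r s → Value v)
    (h₀ : ∀ a V i, ans₀ (M₀ a V) (a.key i) = V i) (N : ℕ) (hN : N = p * v) (E : ℝ)
    (hE : ∑ x : RowKeys p r s × (Fin p → Value v), codeLen N (M₀ x.1 x.2) ≤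
      (N * Real.log 2 + E) * Fintype.card (RowKeys p r s × (Fin p → Value v))) :
    Real.exp (-E / p) * Fintype.card (RowKeys p r s × (Fin p → Value v)) ≤
      ∑ x : RowKeys p r s × (Fin p → Value v), density (possibleKeys M₀ (M₀ x.1 x.2)) := by
  classical
  set X := possibleKeys M₀ with hX
  set θ := Real.exp (-E / p) with hθdef
  have hθ : 0 < θ := Real.exp_pos _
  have hp' : (0 : ℝ) < p := by exact_mod_cast hp
  have hr' : (0 : ℝ) < r := by exact_mod_cast hr
  have hs' : (0 : ℝ) < s := by exact_mod_cast hs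
  have hgibbs := sum_le_of_sum_exp_le
    (Finset.univ : Finset (RowKeys p r s × (Fin p → Value v)))
    (fun x => -codeLen N (M₀ x.1 x.2) + (E - p * (density (X (M₀ x.1 x.2)) / θ - 1)))
    (-(N * Real.log 2)) ?_
  · rw [Finset.card_univ] at hgibbs
    set C : ℝ := (Fintype.card (RowKeys p r s × (Fin p → Value v)) : ℝ) with hC
    simp only [Finset.sum_add_distrib, Finset.sum_sub_distrib, Finset.sum_neg_distrib,
      ← Finset.mul_sum, ← Finset.sum_div, Finset.sum_const, Finset.card_univ, nsmul_eq_mul,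
      mul_one] at hgibbs
    change _ + (C * E - p * (_ - C)) ≤ _ at hgibbs
    have h1 : (p : ℝ) * C ≤
        p * ((∑ x : RowKeys p r s × (Fin p → Value v), density (X (M₀ x.1 x.2))) / θ) := by
      linarith
    have h2 := le_of_mul_le_mul_left h1 hp'
    rw [le_div_iff₀ hθ] at h2
    linarith
  · set I := (Finset.univ : Finset (RowKeys p r s × (Fin p → Value v))).image
      (fun x => M₀ x.1 x.2)
    let f : List Bool × RowKeys p r s → ℝ := fun y =>
      Real.exp (-codeLen N y.1 + (E - p * (density (X y.1) / θ - 1)))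
    let t : Finset (List Bool × RowKeys p r s) :=
      (I ×ˢ Finset.univ).filter fun y => ∀ i, y.2.key i ∈ X y.1
    have h1 := sum_comp_le_of_injOn (s := Finset.univ) (t := t)
      (fun x : RowKeys p r s × (Fin p → Value v) => (M₀ x.1 x.2, x.1)) f ?_ ?_
      (fun y _ => (Real.exp_pos _).le)
    · refine h1.trans ?_
      rw [Finset.sum_filter, Finset.sum_product]
      have h2 : ∀ m ∈ I, (∑ a : RowKeys p r s, if ∀ i, a.key i ∈ X m then f (m, a) else 0) ≤
          Real.exp (-codeLen N m) * ((r : ℝ) * s) ^ p := by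
        intro m _
        rw [← Finset.sum_filter]
        simp only [f]
        rw [Finset.sum_const, nsmul_eq_mul]
        have h3 := card_rowKeys_subset_le hp hr hs (X m) hθ
        have h4 : θ ^ p * Real.exp (E) = 1 := by
          rw [hθdef, ← Real.exp_nat_mul, ← Real.exp_add]
          rw [show (p : ℝ) * (-E / p) + E = 0 by field_simp; ring, Real.exp_zero]
        calc _ ≤ (((r : ℝ) * s) ^ p * (θ ^ p * Real.exp (p * (density (X m) / θ - 1)))) *
              Real.exp (-codeLen N m + (E - p * (density (X m) / θ - 1))) := by gcongr
          _ = Real.exp (-codeLen N m) * ((r : ℝ) * s) ^ p * (θ ^ p * Real.exp E) := by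
            rw [Real.exp_add, Real.exp_sub]
            field_simp
          _ = _ := by rw [h4, mul_one]
      refine (Finset.sum_le_sum h2).trans ?_
      rw [← Finset.sum_mul, Finset.card_univ, Fintype.card_prod, Nat.cast_mul, card_rowKeys,
        card_vals, Fintype.card_fin, mul_assoc, ← Real.exp_add, hN]
      push_cast
      rw [add_neg_cancel, Real.exp_zero, mul_one]
      exact mul_le_of_le_one_left (by positivity) (sum_exp_neg_codeLen_le _ I)
    · intro x _
      simp only [t, Finset.mem_filter, Finset.mem_product, Finset.mem_univ, and_true]
      refine ⟨Finset.mem_image_of_mem _ (Finset.mem_univ x), fun i => ?_⟩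
      simp only [hX, possibleKeys, Finset.mem_filter, Finset.mem_univ, true_and]
      exact ⟨x.1, x.2, rfl, i, rfl⟩
    · rintro ⟨a, V⟩ _ ⟨a', V'⟩ _ h
      simp only [Prod.mk.injEq] at h
      obtain ⟨hm, rfl⟩ := h
      have : V = V' := by
        funext i
        rw [← h₀ a V i, ← h₀ a V' i, hm]
      rw [this]

/-- Row and column transversals without common keys, with values. -/
def disjointInputs (p r s v : ℕ) : Finset
    ((RowKeys p r s × (Fin p → Value v)) × (ColKeys p r s × (Fin r → Value v))) :=
  Finset.univ.filter fun x => ¬ Meets x.1.1 x.2.1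

theorem card_meeting_mul_le (hs : 0 < s) :
    ((Finset.univ.filter fun x : (RowKeys p r s × (Fin p → Value v)) ×
      (ColKeys p r s × (Fin r → Value v)) => Meets x.1.1 x.2.1).card : ℝ) * s ≤
    Fintype.card ((RowKeys p r s × (Fin p → Value v)) × (ColKeys p r s × (Fin r → Value v))) := by
  have h : ((Finset.univ.filter fun x : (RowKeys p r s × (Fin p → Value v)) ×
      (ColKeys p r s × (Fin r → Value v)) => Meets x.1.1 x.2.1).card : ℝ) =
      ∑ y : RowKeys p r s × (Fin p → Value v), ∑ _V : Fin r → Value v,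
        ((Finset.univ.filter fun b => Meets y.1 b).card : ℝ) := by
    rw [Finset.card_filter]
    push_cast
    rw [Fintype.sum_prod_type]
    refine Finset.sum_congr rfl fun y _ => ?_
    rw [Fintype.sum_prod_type_right]
    simp
  rw [h, Finset.sum_mul]
  simp_rw [Finset.sum_mul]
  calc _ ≤ ∑ y : RowKeys p r s × (Fin p → Value v), ∑ _V : Fin r → Value v,
        (Fintype.card (ColKeys p r s) : ℝ) :=
      Finset.sum_le_sum fun y _ => Finset.sum_le_sum fun V _ => card_meets_mul_le hs y.1
    _ = _ := by
      simp only [Finset.sum_const, Finset.card_univ, nsmul_eq_mul, Fintype.card_prod]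
      push_cast
      ring

theorem card_le_card_disjointInputs (hs : 0 < s) :
    (Fintype.card ((RowKeys p r s × (Fin p → Value v)) × (ColKeys p r s × (Fin r → Value v))) : ℝ)
      * (1 - 1 / s) ≤ (disjointInputs p r s v).card := by
  have h1 := card_meeting_mul_le (p := p) (r := r) (v := v) hs
  have hs' : (0 : ℝ) < s := by exact_mod_cast hs
  rw [← le_div_iff₀ hs'] at h1
  have h2 := Finset.card_filter_add_card_filter_not (s := (Finset.univ : Finset
    ((RowKeys p r s × (Fin p → Value v)) × (ColKeys p r s × (Fin r → Value v)))))
    (fun x => Meets x.1.1 x.2.1)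
  rw [Finset.card_univ] at h2
  have h3 := congrArg (Nat.cast (R := ℝ)) h2
  push_cast at h3
  unfold disjointInputs
  rw [mul_sub, mul_one, mul_one_div]
  simp only [Fintype.card_prod, Nat.cast_mul] at *
  linarith

/-- A random column transversal has `r * density X` keys in `X` on average. -/
theorem sum_hits (hp : 0 < p) (hr : 0 < r) (hs : 0 < s) (X : Finset (Point p r s)) :
    ∑ b : ColKeys p r s, (hits b X : ℝ) = Fintype.card (ColKeys p r s) * (r * density X) := by
  have hp' : (0 : ℝ) < p := by exact_mod_cast hp
  have hr' : (0 : ℝ) < r := by exact_mod_cast hr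
  have hs' : (0 : ℝ) < s := by exact_mod_cast hs
  have hj : ∀ j : Fin r, (∑ b : ColKeys p r s, if b.key j ∈ X then (1 : ℝ) else 0) * (p * s) =
      Fintype.card (ColKeys p r s) * ((Finset.univ.filter fun c : Fin p × Fin s =>
        (c.1, j, c.2) ∈ X).card : ℝ) := by
    intro j
    have := sum_apply_mul_card (ι := Fin r) (β := Fin p × Fin s) j
      (fun c => if (c.1, j, c.2) ∈ X then 1 else 0)
    have hb : (∑ c : Fin p × Fin s, if (c.1, j, c.2) ∈ X then (1 : ℝ) else 0) =
        ((Finset.univ.filter fun c : Fin p × Fin s => (c.1, j, c.2) ∈ X).card : ℝ) :=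
      Finset.sum_boole _ _
    rw [← hb, ← this]
    simp only [Fintype.card_prod, Fintype.card_fin, Nat.cast_mul]
    rfl
  have h1 : (∑ b : ColKeys p r s, (hits b X : ℝ)) * (p * s) =
      Fintype.card (ColKeys p r s) * X.card := by
    simp_rw [hits, Finset.card_filter]
    push_cast
    rw [Finset.sum_comm, Finset.sum_mul, card_eq_sum_cols]
    push_cast
    rw [Finset.mul_sum]
    exact Finset.sum_congr rfl fun j _ => hj j
  rw [density, ← mul_right_cancel_iff_of_pos (mul_pos hp' hs'), h1]
  field_simp

theorem disjointInputs_nonempty (hp : 0 < p) (hr : 0 < r) (hs : 2 ≤ s) :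
    0 < ((disjointInputs p r s v).card : ℝ) := by
  have : Nonempty (Fin p) := ⟨⟨0, hp⟩⟩
  have : Nonempty (Fin r) := ⟨⟨0, hr⟩⟩
  have : Nonempty (Fin s) := ⟨⟨0, by omega⟩⟩
  refine lt_of_lt_of_le ?_ (card_le_card_disjointInputs (by omega))
  have h2 : (2 : ℝ) ≤ s := by exact_mod_cast hs
  have h3 : (1 : ℝ) / s ≤ 1 / 2 := one_div_le_one_div_of_le (by norm_num) h2
  refine mul_pos (by exact_mod_cast Fintype.card_pos) (by linarith)

theorem card_le_two_mul_disjointInputs (hs : 2 ≤ s) :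
    (Fintype.card ((RowKeys p r s × (Fin p → Value v)) × (ColKeys p r s × (Fin r → Value v))) : ℝ)
      ≤ 2 * (disjointInputs p r s v).card := by
  have h := card_le_card_disjointInputs (p := p) (r := r) (s := s) (v := v) (by omega)
  have h2 : (2 : ℝ) ≤ s := by exact_mod_cast hs
  have h3 : (1 : ℝ) / s ≤ 1 / 2 := one_div_le_one_div_of_le (by norm_num) h2
  have h4 : (0 : ℝ) ≤ Fintype.card ((RowKeys p r s × (Fin p → Value v)) ×
    (ColKeys p r s × (Fin r → Value v))) := Nat.cast_nonneg _
  nlinarith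

theorem sum_disjointInputs (f : (RowKeys p r s × (Fin p → Value v)) ×
    (ColKeys p r s × (Fin r → Value v)) → ℝ) :
    ∑ x ∈ disjointInputs p r s v, f x =
      ∑ y, ∑ b, ∑ V₁, if Meets y.1 b then 0 else f (y, (b, V₁)) := by
  rw [disjointInputs, Finset.sum_filter, Fintype.sum_prod_type]
  refine Finset.sum_congr rfl fun y _ => ?_
  rw [Fintype.sum_prod_type]
  simp only [ite_not]

section Insertion

variable (M₀ : RowKeys p r s → (Fin p → Value v) → List Bool)
  (F : List Bool → ColKeys p r s → (Fin r → Value v) → List Bool)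
  (ans₀ ans₁ : List Bool → Point p r s → Value v)

/-- The keys that are possible for the first memory and whose answer changes. -/
noncomputable def changedKeys (m₀ m₁ : List Bool) : Finset (Point p r s) :=
  (possibleKeys M₀ m₀).filter fun x => ans₁ m₁ x ≠ ans₀ m₀ x

variable (h₀ : ∀ a V i, ans₀ (M₀ a V) (a.key i) = V i)
  (h₁row : ∀ a b V V₁, ¬ Meets a b → ∀ i, ans₁ (F (M₀ a V) b V₁) (a.key i) = V i)
  (h₁col : ∀ a b V V₁, ¬ Meets a b → ∀ j, ans₁ (F (M₀ a V) b V₁) (b.key j) = V₁ j)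

include h₀ h₁row in
/-- Changed keys are rare: fix for every possible key a row transversal `w` that contains it and
leads to `m₀`. Whenever the second batch does not meet `w`, the operations are also legal after `w`
and the answer for the key has to be preserved. -/
theorem sum_card_changedKeys_le (hs : 0 < s) (m₀ : List Bool) (V₁ : Fin r → Value v) :
    (∑ b, ((changedKeys M₀ ans₀ ans₁ m₀ (F m₀ b V₁)).card : ℝ)) * s ≤
      p * (r * s) * Fintype.card (ColKeys p r s) := by
  classical
  have hw : ∀ x : Point p r s, ∃ a : RowKeys p r s, x ∈ possibleKeys M₀ m₀ →
      ∃ V, M₀ a V = m₀ ∧ ∃ i, a.key i = x := by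
    intro x
    by_cases hx : x ∈ possibleKeys M₀ m₀
    · obtain ⟨a, V, h⟩ := (Finset.mem_filter.1 hx).2
      exact ⟨a, fun _ => ⟨V, h⟩⟩
    · rcases isEmpty_or_nonempty (RowKeys p r s) with he | ⟨⟨a⟩⟩
      · exact (he.false fun _ => x.2).elim
      · exact ⟨a, fun h => (hx h).elim⟩
  choose w hw using hw
  have hsub : ∀ b, changedKeys M₀ ans₀ ans₁ m₀ (F m₀ b V₁) ⊆
      Finset.univ.filter fun x => Meets (w x) b := by
    intro b x hx
    obtain ⟨hx, hne⟩ := Finset.mem_filter.1 hx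
    refine Finset.mem_filter.2 ⟨Finset.mem_univ _, ?_⟩
    by_contra hm
    obtain ⟨V, hV, i, hi⟩ := hw x hx
    apply hne
    have e1 := h₁row (w x) b V V₁ hm i
    have e0 := h₀ (w x) V i
    rw [hV, hi] at e1 e0
    rw [e1, e0]
  calc _ ≤ (∑ b, ((Finset.univ.filter fun x => Meets (w x) b).card : ℝ)) * s := by
        gcongr with b
        exact hsub b
    _ = ∑ x, ((Finset.univ.filter fun b => Meets (w x) b).card : ℝ) * s := by
        simp_rw [Finset.card_filter]
        push_cast
        rw [Finset.sum_comm, Finset.sum_mul]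
    _ ≤ ∑ x : Point p r s, (Fintype.card (ColKeys p r s) : ℝ) :=
        Finset.sum_le_sum fun x _ => card_meets_mul_le hs (w x)
    _ = _ := by simp

include h₀ h₁row in
theorem sum_density_changedKeys_le (hp : 0 < p) (hr : 0 < r) (hs : 2 ≤ s) :
    ∑ x ∈ disjointInputs p r s v, density (changedKeys M₀ ans₀ ans₁ (M₀ x.1.1 x.1.2)
      (F (M₀ x.1.1 x.1.2) x.2.1 x.2.2)) ≤ (disjointInputs p r s v).card * (2 / s) := by
  have hp' : (0 : ℝ) < p := by exact_mod_cast hp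
  have hr' : (0 : ℝ) < r := by exact_mod_cast hr
  have hs' : (0 : ℝ) < s := by exact_mod_cast (by omega : 0 < s)
  have h1 : ∑ x : (RowKeys p r s × (Fin p → Value v)) × (ColKeys p r s × (Fin r → Value v)),
      density (changedKeys M₀ ans₀ ans₁ (M₀ x.1.1 x.1.2)
        (F (M₀ x.1.1 x.1.2) x.2.1 x.2.2)) ≤
      ∑ y : RowKeys p r s × (Fin p → Value v), ∑ _V : Fin r → Value v,
        (Fintype.card (ColKeys p r s) : ℝ) / s := by
    rw [Fintype.sum_prod_type]
    refine Finset.sum_le_sum fun y _ => ?_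
    rw [Fintype.sum_prod_type_right]
    refine Finset.sum_le_sum fun V₁ _ => ?_
    have h := sum_card_changedKeys_le M₀ F ans₀ ans₁ h₀ h₁row (by omega) (M₀ y.1 y.2) V₁
    simp only [density]
    rw [← Finset.sum_div, div_le_div_iff₀ (by positivity) hs']
    linarith
  have h2 : ∑ y : RowKeys p r s × (Fin p → Value v), ∑ _V : Fin r → Value v,
        (Fintype.card (ColKeys p r s) : ℝ) / s =
      (Fintype.card ((RowKeys p r s × (Fin p → Value v)) ×
        (ColKeys p r s × (Fin r → Value v))) : ℝ) / s := by
    simp only [Finset.sum_const, Finset.card_univ, nsmul_eq_mul, Fintype.card_prod]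
    push_cast
    ring
  refine (Finset.sum_le_sum_of_subset_of_nonneg (Finset.subset_univ _)
    fun _ _ _ => density_nonneg _).trans (h1.trans (h2.trans_le ?_))
  rw [mul_div_assoc', div_le_div_iff_of_pos_right hs', mul_comm]
  exact card_le_two_mul_disjointInputs hs

include h₁col in
/-- An inserted key that was possible before changes its answer unless its new value happens to be
the old answer, which has probability at most one half. -/
theorem le_sum_hits_changedKeys (hp : 0 < p) (hr : 0 < r) (hs : 0 < s) (hv : 1 ≤ v) (θ : ℝ)
    (hθ : θ * Fintype.card (RowKeys p r s × (Fin p → Value v)) ≤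
      ∑ x : RowKeys p r s × (Fin p → Value v), density (possibleKeys M₀ (M₀ x.1 x.2))) :
    (r : ℝ) / 2 * (θ - 1 / s) * Fintype.card ((RowKeys p r s × (Fin p → Value v)) ×
        (ColKeys p r s × (Fin r → Value v))) ≤
      ∑ x ∈ disjointInputs p r s v, (hits x.2.1 (changedKeys M₀ ans₀ ans₁ (M₀ x.1.1 x.1.2)
        (F (M₀ x.1.1 x.1.2) x.2.1 x.2.2)) : ℝ) := by
  have hs' : (0 : ℝ) < s := by exact_mod_cast hs
  set X := possibleKeys M₀
  -- Averaging over the new values loses at most a factor two.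
  have h1 : ∑ x ∈ disjointInputs p r s v, (hits x.2.1 (X (M₀ x.1.1 x.1.2)) : ℝ) / 2 ≤
      ∑ x ∈ disjointInputs p r s v, (hits x.2.1 (changedKeys M₀ ans₀ ans₁ (M₀ x.1.1 x.1.2)
        (F (M₀ x.1.1 x.1.2) x.2.1 x.2.2)) : ℝ) := by
    rw [sum_disjointInputs, sum_disjointInputs]
    refine Finset.sum_le_sum fun y _ => Finset.sum_le_sum fun b _ => ?_
    by_cases hm : Meets y.1 b
    · simp only [hm, if_true, le_refl]
    · simp only [hm, if_false]
      rw [Finset.sum_const, Finset.card_univ, nsmul_eq_mul]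
      refine (half_mul_card_le_sum_ne hv (fun j => ans₀ (M₀ y.1 y.2) (b.key j))
        (Finset.univ.filter fun j => b.key j ∈ X (M₀ y.1 y.2))).trans (le_of_eq ?_)
      refine Finset.sum_congr rfl fun V₁ _ => ?_
      rw [hits, Finset.filter_filter]
      congr 2
      ext j
      simp only [changedKeys, Finset.mem_filter, Finset.mem_univ, true_and,
        h₁col y.1 b y.2 V₁ hm j]
      rfl
  have h2 : ∑ x : (RowKeys p r s × (Fin p → Value v)) × (ColKeys p r s × (Fin r → Value v)),
      (hits x.2.1 (X (M₀ x.1.1 x.1.2)) : ℝ) =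
      (∑ y : RowKeys p r s × (Fin p → Value v), density (X (M₀ y.1 y.2))) *
        (r * Fintype.card (ColKeys p r s × (Fin r → Value v))) := by
    rw [Fintype.sum_prod_type, Finset.sum_mul]
    refine Finset.sum_congr rfl fun y _ => ?_
    rw [Fintype.sum_prod_type_right]
    simp only [sum_hits hp hr hs]
    simp only [Finset.sum_const, Finset.card_univ, nsmul_eq_mul, Fintype.card_prod]
    push_cast
    ring
  have h3 := Finset.sum_filter_add_sum_filter_not (Finset.univ : Finset
    ((RowKeys p r s × (Fin p → Value v)) × (ColKeys p r s × (Fin r → Value v))))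
    (fun x => Meets x.1.1 x.2.1) (fun x => (hits x.2.1 (X (M₀ x.1.1 x.1.2)) : ℝ))
  have h4 : ∑ x ∈ Finset.univ.filter (fun x : (RowKeys p r s × (Fin p → Value v)) ×
      (ColKeys p r s × (Fin r → Value v)) => Meets x.1.1 x.2.1),
      (hits x.2.1 (X (M₀ x.1.1 x.1.2)) : ℝ) ≤
      r * (Fintype.card ((RowKeys p r s × (Fin p → Value v)) ×
        (ColKeys p r s × (Fin r → Value v))) / s) := by
    have h5 := card_meeting_mul_le (p := p) (r := r) (v := v) hs
    rw [← le_div_iff₀ hs'] at h5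
    refine (Finset.sum_le_card_nsmul _ _ (r : ℝ) fun x _ => ?_).trans ?_
    · unfold hits
      exact_mod_cast (Finset.card_le_univ _).trans (by simp)
    · rw [nsmul_eq_mul, mul_comm]
      gcongr
  have h6 : θ * Fintype.card ((RowKeys p r s × (Fin p → Value v)) ×
        (ColKeys p r s × (Fin r → Value v))) ≤
      (∑ y : RowKeys p r s × (Fin p → Value v), density (X (M₀ y.1 y.2))) *
        Fintype.card (ColKeys p r s × (Fin r → Value v)) := by
    rw [Fintype.card_prod (RowKeys p r s × (Fin p → Value v)), Nat.cast_mul, ← mul_assoc]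
    gcongr
  change _ + ∑ x ∈ disjointInputs p r s v, _ = _ at h3
  rw [← Finset.sum_div] at h1
  have h7 := mul_le_mul_of_nonneg_left h6 (Nat.cast_nonneg r : (0 : ℝ) ≤ r)
  set C : ℝ := (Fintype.card ((RowKeys p r s × (Fin p → Value v)) ×
        (ColKeys p r s × (Fin r → Value v))) : ℝ)
  have h8 : (r : ℝ) / 2 * (θ - 1 / s) * C = (r * (θ * C) - r * (C / s)) / 2 := by
    field_simp
  rw [h8]
  linarith

include h₀ h₁row h₁col in
/-- The tradeoff for insertions: the second memory determines, given the row transversal, the values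
of the first batch, hence the first memory and the set of changed keys, so that it saves `log t` on
each inserted key in that set. Here `E₀` and `E₁` are the redundancies, in nats, of the memories
after the first and the second batch. -/
theorem insertion_tradeoff (hp : 0 < p) (hr : 0 < r) (hs : 2 ≤ s) (hv : 1 ≤ v) {t : ℝ}
    (ht : 1 ≤ t) (N₀ N₁ : ℕ) (hN₀ : N₀ = p * v) (hN₁ : N₁ = (p + r) * v) (E₀ E₁ : ℝ)
    (hE₀ : ∑ x : RowKeys p r s × (Fin p → Value v), codeLen N₀ (M₀ x.1 x.2) ≤
      (N₀ * Real.log 2 + E₀) * Fintype.card (RowKeys p r s × (Fin p → Value v)))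
    (hE₁ : ∑ x ∈ disjointInputs p r s v, codeLen N₁ (F (M₀ x.1.1 x.1.2) x.2.1 x.2.2) ≤
      (N₁ * Real.log 2 + E₁) * (disjointInputs p r s v).card)
    (hE : 1 / (s : ℝ) ≤ Real.exp (-E₀ / p)) :
    (r : ℝ) / 2 * (Real.exp (-E₀ / p) - 1 / s) * Real.log t - (t - 1) * r * (2 / s) ≤
      E₁ + Real.log 2 := by
  classical
  have hs0 : 0 < s := by omega
  set Ω' := disjointInputs p r s v with hΩ
  set D := changedKeys M₀ ans₀ ans₁ with hD
  let m₁ : (RowKeys p r s × (Fin p → Value v)) × (ColKeys p r s × (Fin r → Value v)) → List Bool :=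
    fun x => F (M₀ x.1.1 x.1.2) x.2.1 x.2.2
  have hθ := exp_mul_card_le_sum_density hp hr hs0 M₀ ans₀ h₀ N₀ hN₀ E₀ hE₀
  have hhits := le_sum_hits_changedKeys M₀ F ans₀ ans₁ h₁col hp hr hs0 hv _ hθ
  have hdens := sum_density_changedKeys_le M₀ F ans₀ ans₁ h₀ h₁row hp hr hs
  have hpos : 0 < (Ω'.card : ℝ) := disjointInputs_nonempty hp hr hs
  have hgibbs := sum_le_of_sum_exp_le Ω'
    (fun x => -codeLen N₁ (m₁ x) + (hits x.2.1 (D (M₀ x.1.1 x.1.2) (m₁ x)) * Real.log t -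
      (t - 1) * r * density (D (M₀ x.1.1 x.1.2) (m₁ x))))
    (Real.log 2 - N₁ * Real.log 2) ?_
  · simp only [Finset.sum_add_distrib, Finset.sum_sub_distrib, Finset.sum_neg_distrib,
      ← Finset.mul_sum, ← Finset.sum_mul] at hgibbs
    have hlt : 0 ≤ Real.log t := Real.log_nonneg ht
    have h1 : (r : ℝ) / 2 * (Real.exp (-E₀ / p) - 1 / s) * Ω'.card ≤
        ∑ x ∈ Ω', (hits x.2.1 (D (M₀ x.1.1 x.1.2) (m₁ x)) : ℝ) := by
      refine le_trans ?_ hhits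
      have : (Ω'.card : ℝ) ≤ Fintype.card ((RowKeys p r s × (Fin p → Value v)) ×
        (ColKeys p r s × (Fin r → Value v))) := by exact_mod_cast Finset.card_le_univ _
      have h0 : 0 ≤ Real.exp (-E₀ / p) - 1 / s := by linarith
      gcongr
    have h2 := mul_le_mul_of_nonneg_right h1 hlt
    have h3 := mul_le_mul_of_nonneg_left hdens
      (mul_nonneg (by linarith) (Nat.cast_nonneg r) : 0 ≤ (t - 1) * (r : ℝ))
    change ∑ x ∈ Ω', codeLen N₁ (m₁ x) ≤ _ at hE₁
    change (t - 1) * r * ∑ x ∈ Ω', density (D (M₀ x.1.1 x.1.2) (m₁ x)) ≤ _ at h3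
    refine le_of_mul_le_mul_right (a := (Ω'.card : ℝ)) ?_ hpos
    linarith
  · set I := Ω'.image m₁
    -- On disjoint inputs the first memory is a function of `a` and the second memory.
    let g₀ : RowKeys p r s → List Bool → List Bool := fun a m => M₀ a fun i => ans₁ m (a.key i)
    have hg₀ : ∀ x ∈ Ω', (fun i => ans₁ (m₁ x) (x.1.1.key i)) = x.1.2 := by
      intro x hx
      funext i
      exact h₁row _ _ _ _ (Finset.mem_filter.1 hx).2 i
    let f : RowKeys p r s × List Bool × ColKeys p r s → ℝ := fun y =>
      Real.exp (-codeLen N₁ y.2.1 + (hits y.2.2 (D (g₀ y.1 y.2.1) y.2.1) * Real.log t -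
        (t - 1) * r * density (D (g₀ y.1 y.2.1) y.2.1)))
    have h1 := sum_comp_le_of_injOn (s := Ω') (t := Finset.univ ×ˢ I ×ˢ Finset.univ)
      (fun x => (x.1.1, m₁ x, x.2.1)) f ?_ ?_ (fun y _ => (Real.exp_pos _).le)
    · refine le_trans (le_of_eq ?_) (h1.trans ?_)
      · refine Finset.sum_congr rfl fun x hx => ?_
        simp only [f, g₀, hg₀ x hx]
      · simp only [Finset.sum_product, f, Real.exp_add (-codeLen _ _), ← Finset.mul_sum]
        calc _ ≤ ∑ a : RowKeys p r s, ∑ m ∈ I, Real.exp (-codeLen N₁ m) *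
              (Fintype.card (ColKeys p r s) : ℝ) := by
              gcongr with a _ m _
              exact sum_exp_hits_le hp hr hs0 _ ht
          _ ≤ ∑ a : RowKeys p r s, (Fintype.card (ColKeys p r s) : ℝ) := by
              refine Finset.sum_le_sum fun a _ => ?_
              rw [← Finset.sum_mul]
              exact mul_le_of_le_one_left (Nat.cast_nonneg _) (sum_exp_neg_codeLen_le _ _)
          _ ≤ _ := by
              have h2 := card_le_two_mul_disjointInputs (p := p) (r := r) (v := v) hs
              have h3 : (Fintype.card ((RowKeys p r s × (Fin p → Value v)) ×
                  (ColKeys p r s × (Fin r → Value v))) : ℝ) =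
                  Fintype.card (RowKeys p r s) * Fintype.card (ColKeys p r s) *
                    Real.exp (N₁ * Real.log 2) := by
                rw [Fintype.card_prod, Fintype.card_prod, Fintype.card_prod]
                push_cast
                rw [card_vals, card_vals, hN₁, Fintype.card_fin, Fintype.card_fin]
                push_cast
                rw [show ((p : ℝ) + r) * v * Real.log 2 =
                  p * v * Real.log 2 + r * v * Real.log 2 by ring, Real.exp_add]
                ring
              rw [h3] at h2
              rw [Finset.sum_const, nsmul_eq_mul, Finset.card_univ, Real.exp_sub,
                Real.exp_log (by norm_num), mul_div_assoc', le_div_iff₀ (Real.exp_pos _)]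
              rw [mul_comm ((Ω'.card : ℝ))]
              exact h2
    · intro x hx
      simp only [Finset.mem_product, Finset.mem_univ, true_and, and_true]
      exact Finset.mem_image_of_mem _ hx
    · intro x hx y hy h
      simp only [Prod.mk.injEq] at h
      obtain ⟨ha, hm, hb⟩ := h
      have hV : x.1.2 = y.1.2 := by rw [← hg₀ x hx, ← hg₀ y hy, hm, ha]
      have hV1 : x.2.2 = y.2.2 := by
        funext j
        have e1 := h₁col x.1.1 x.2.1 x.1.2 x.2.2 (Finset.mem_filter.1 hx).2 j
        have e2 := h₁col y.1.1 y.2.1 y.1.2 y.2.2 (Finset.mem_filter.1 hy).2 j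
        change ans₁ (m₁ x) _ = _ at e1
        change ans₁ (m₁ y) _ = _ at e2
        rw [← e1, ← e2, hm, hb]
      exact Prod.ext (Prod.ext ha hV) (Prod.ext hb hV1)

end Insertion

/-! ### Updates: the keys whose answers change -/

theorem card_inputs (p r s v : ℕ) :
    (Fintype.card ((RowKeys p r s × (Fin p → Value v)) × (ColKeys p r s × (Fin r → Value v))) : ℝ)
      = Fintype.card (RowKeys p r s) * Fintype.card (ColKeys p r s) *
        Real.exp (((p + r) * v : ℕ) * Real.log 2) := by
  rw [Fintype.card_prod, Fintype.card_prod, Fintype.card_prod]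
  push_cast
  rw [card_vals, card_vals, Fintype.card_fin, Fintype.card_fin,
    show ((p : ℝ) + r) * v * Real.log 2 = p * v * Real.log 2 + r * v * Real.log 2 by ring,
    Real.exp_add]
  ring

theorem density_compl (hp : 0 < p) (hr : 0 < r) (hs : 0 < s) (D : Finset (Point p r s)) :
    density Dᶜ = 1 - density D := by
  have hp' : (0 : ℝ) < p := by exact_mod_cast hp
  have hr' : (0 : ℝ) < r := by exact_mod_cast hr
  have hs' : (0 : ℝ) < s := by exact_mod_cast hs
  have h := Finset.card_add_card_compl D
  have h2 := congrArg (Nat.cast (R := ℝ)) h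
  simp only [Fintype.card_prod, Fintype.card_fin] at h2
  push_cast at h2
  unfold density
  rw [eq_sub_iff_add_eq, ← add_div, add_comm, h2]
  field_simp

section Update

variable (M₀ : (RowKeys p r s × (Fin p → Value v)) × (ColKeys p r s × (Fin r → Value v)) →
    List Bool)
  (F : List Bool → ColKeys p r s → (Fin r → Value v) → List Bool)
  (ans₀ ans₁ : List Bool → Point p r s → Value v)

/-- Row and column transversals without common keys, with values, and new values for the keys of the
column transversal. -/
def updateInputs (p r s v : ℕ) : Finset
    (((RowKeys p r s × (Fin p → Value v)) × (ColKeys p r s × (Fin r → Value v))) ×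
      (Fin r → Value v)) :=
  disjointInputs p r s v ×ˢ Finset.univ

/-- The keys that are answered differently from the two memories. -/
def differ (m₀ m₁ : List Bool) : Finset (Point p r s) :=
  Finset.univ.filter fun x => ans₁ m₁ x ≠ ans₀ m₀ x

theorem not_meets_of_mem {x : ((RowKeys p r s × (Fin p → Value v)) ×
    (ColKeys p r s × (Fin r → Value v))) × (Fin r → Value v)} (hx : x ∈ updateInputs p r s v) :
    ¬ Meets x.1.1.1 x.1.2.1 :=
  (Finset.mem_filter.1 (Finset.mem_product.1 hx).1).2

theorem le_card_updateInputs (hs : 2 ≤ s) :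
    (Fintype.card (RowKeys p r s) : ℝ) * Fintype.card (ColKeys p r s) *
      Real.exp (((p + r) * v : ℕ) * Real.log 2) * Real.exp (r * v * Real.log 2) ≤
      2 * (updateInputs p r s v).card := by
  have h := card_le_two_mul_disjointInputs (p := p) (r := r) (v := v) hs
  rw [card_inputs] at h
  have hS : ((updateInputs p r s v).card : ℝ) =
      (disjointInputs p r s v).card * Real.exp (r * v * Real.log 2) := by
    rw [updateInputs, Finset.card_product, Finset.card_univ, Nat.cast_mul, card_vals,
      Fintype.card_fin]
  rw [hS, ← mul_assoc]
  gcongr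

variable (h₀row : ∀ a V b W, ¬ Meets a b → ∀ i, ans₀ (M₀ ((a, V), (b, W))) (a.key i) = V i)
  (h₀col : ∀ a V b W, ¬ Meets a b → ∀ j, ans₀ (M₀ ((a, V), (b, W))) (b.key j) = W j)
  (h₁row : ∀ a V b W V₁, ¬ Meets a b → ∀ i,
    ans₁ (F (M₀ ((a, V), (b, W))) b V₁) (a.key i) = V i)
  (h₁col : ∀ a V b W V₁, ¬ Meets a b → ∀ j,
    ans₁ (F (M₀ ((a, V), (b, W))) b V₁) (b.key j) = V₁ j)

include h₀row h₀col h₁row in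
/-- Few answers change: given `m₀`, the column transversal and its new values, the set `differ` is
determined and the row transversal avoids it, so a dense set would reveal the row transversal. -/
theorem mul_sum_density_differ_le (hp : 0 < p) (hr : 0 < r) (hs : 2 ≤ s) (N : ℕ)
    (hN : N = (p + r) * v) (E₀ : ℝ)
    (hE₀ : ∑ x ∈ updateInputs p r s v, codeLen N (M₀ x.1) ≤
      (N * Real.log 2 + E₀) * (updateInputs p r s v).card) :
    p * ∑ x ∈ updateInputs p r s v,
        density (differ ans₀ ans₁ (M₀ x.1) (F (M₀ x.1) x.1.2.1 x.2)) ≤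
      (updateInputs p r s v).card * (E₀ + Real.log 2) := by
  classical
  have hs0 : 0 < s := by omega
  set S := updateInputs p r s v with hS
  set D := differ ans₀ ans₁ with hD
  have hgibbs := sum_le_of_sum_exp_le S
    (fun x => -codeLen N (M₀ x.1) + p * density (D (M₀ x.1) (F (M₀ x.1) x.1.2.1 x.2)))
    (Real.log 2 - N * Real.log 2) ?_
  · simp only [Finset.sum_add_distrib, Finset.sum_neg_distrib, ← Finset.mul_sum] at hgibbs
    linarith
  · set I := S.image fun x => M₀ x.1
    let f : (ColKeys p r s × (Fin r → Value v)) × List Bool × RowKeys p r s → ℝ := fun y =>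
      Real.exp (-codeLen N y.2.1 + p * density (D y.2.1 (F y.2.1 y.1.1 y.1.2)))
    let t : Finset ((ColKeys p r s × (Fin r → Value v)) × List Bool × RowKeys p r s) :=
      (Finset.univ ×ˢ I ×ˢ Finset.univ).filter fun y =>
        ∀ i, y.2.2.key i ∈ (D y.2.1 (F y.2.1 y.1.1 y.1.2))ᶜ
    have h1 := sum_comp_le_of_injOn (s := S) (t := t)
      (fun x => ((x.1.2.1, x.2), (M₀ x.1, x.1.1.1))) f ?_ ?_ (fun y _ => (Real.exp_pos _).le)
    · refine h1.trans ?_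
      rw [Finset.sum_filter, Finset.sum_product]
      have h2 : ∀ y : ColKeys p r s × (Fin r → Value v), ∀ m ∈ I,
          (∑ a : RowKeys p r s, if ∀ i, a.key i ∈ (D m (F m y.1 y.2))ᶜ then f (y, m, a) else 0) ≤
          Real.exp (-codeLen N m) * Fintype.card (RowKeys p r s) := by
        intro y m _
        rw [← Finset.sum_filter]
        simp only [f]
        rw [Finset.sum_const, nsmul_eq_mul]
        have h3 := card_rowKeys_subset_le hp hr hs0 (D m (F m y.1 y.2))ᶜ one_pos
        rw [density_compl hp hr hs0, one_pow, one_mul, div_one, ← card_rowKeys] at h3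
        calc _ ≤ (Fintype.card (RowKeys p r s) *
                Real.exp (p * (1 - density (D m (F m y.1 y.2)) - 1))) *
              Real.exp (-codeLen N m + p * density (D m (F m y.1 y.2))) := by gcongr
          _ = Real.exp (-codeLen N m) * Fintype.card (RowKeys p r s) := by
            rw [mul_assoc, ← Real.exp_add, mul_comm]
            congr 2
            ring
      calc _ ≤ ∑ y : ColKeys p r s × (Fin r → Value v), (Fintype.card (RowKeys p r s) : ℝ) := by
            refine Finset.sum_le_sum fun y _ => ?_
            rw [Finset.sum_product]
            refine (Finset.sum_le_sum (h2 y)).trans ?_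
            rw [← Finset.sum_mul]
            exact mul_le_of_le_one_left (Nat.cast_nonneg _) (sum_exp_neg_codeLen_le _ _)
        _ ≤ _ := by
            have h4 := le_card_updateInputs (p := p) (r := r) (v := v) hs
            rw [← hN] at h4
            rw [Finset.sum_const, nsmul_eq_mul, Finset.card_univ, Fintype.card_prod,
              Nat.cast_mul, card_vals, Fintype.card_fin, Real.exp_sub,
              Real.exp_log (by norm_num), mul_div_assoc', le_div_iff₀ (Real.exp_pos _)]
            linarith
    · intro x hx
      have hm := not_meets_of_mem hx
      obtain ⟨⟨⟨a, V⟩, b, W⟩, V₁⟩ := x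
      simp only [t, Finset.mem_filter, Finset.mem_product, Finset.mem_univ, and_true, true_and]
      refine ⟨Finset.mem_image.2 ⟨_, hx, rfl⟩, fun i => ?_⟩
      simp only [hD, differ, Finset.compl_filter, Finset.mem_filter, Finset.mem_univ, true_and,
        not_not]
      rw [h₁row a V b W V₁ hm i, h₀row a V b W hm i]
    · intro x hx x' hx' h
      have hm := not_meets_of_mem hx
      have hm' := not_meets_of_mem hx'
      obtain ⟨⟨⟨a, V⟩, b, W⟩, V₁⟩ := x
      obtain ⟨⟨⟨a', V'⟩, b', W'⟩, V₁'⟩ := x'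
      simp only [Prod.mk.injEq] at h
      obtain ⟨⟨rfl, rfl⟩, hM, rfl⟩ := h
      have hV : V = V' := by
        funext i; rw [← h₀row a V b W hm i, ← h₀row a V' b W' hm' i, hM]
      have hW : W = W' := by
        funext j; rw [← h₀col a V b W hm j, ← h₀col a V' b W' hm' j, hM]
      rw [hV, hW]

include h₀col h₁col in
theorem le_sum_hits_differ (hv : 1 ≤ v) :
    (r : ℝ) / 2 * (updateInputs p r s v).card ≤ ∑ x ∈ updateInputs p r s v,
      (hits x.1.2.1 (differ ans₀ ans₁ (M₀ x.1) (F (M₀ x.1) x.1.2.1 x.2)) : ℝ) := by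
  rw [updateInputs, Finset.sum_product, Finset.card_product, Nat.cast_mul, Finset.card_univ]
  have h : ∀ y ∈ disjointInputs p r s v, (Fintype.card (Fin r → Value v) : ℝ) * (r / 2) ≤
      ∑ V₁ : Fin r → Value v,
        (hits y.2.1 (differ ans₀ ans₁ (M₀ y) (F (M₀ y) y.2.1 V₁)) : ℝ) := by
    rintro ⟨⟨a, V⟩, b, W⟩ hy
    have hm : ¬ Meets a b := (Finset.mem_filter.1 hy).2
    have := half_mul_card_le_sum_ne hv W Finset.univ
    rw [Finset.card_univ, Fintype.card_fin] at this
    refine this.trans (le_of_eq (Finset.sum_congr rfl fun V₁ _ => ?_))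
    rw [hits]
    congr 2
    ext j
    simp only [differ, Finset.mem_filter, Finset.mem_univ, true_and, h₁col a V b W V₁ hm j,
      h₀col a V b W hm j]
  calc _ = ∑ y ∈ disjointInputs p r s v, (Fintype.card (Fin r → Value v) : ℝ) * (r / 2) := by
        rw [Finset.sum_const, nsmul_eq_mul]; ring
    _ ≤ _ := Finset.sum_le_sum h

include h₀row h₀col h₁row h₁col in
/-- The tradeoff for updates: the set `differ` contains every updated key whose value changes,
and saves `log t` on each of them, up to the cost of its density. The code for the second memory is
conditioned on the row transversal and its values, which the first memory determines. -/
theorem update_tradeoff (hp : 0 < p) (hr : 0 < r) (hs : 2 ≤ s) (hv : 1 ≤ v) {t : ℝ} (ht : 1 ≤ t)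
    (N : ℕ) (hN : N = (p + r) * v) (E₀ E₁ : ℝ)
    (hE₀ : ∑ x ∈ updateInputs p r s v, codeLen N (M₀ x.1) ≤
      (N * Real.log 2 + E₀) * (updateInputs p r s v).card)
    (hE₁ : ∑ x ∈ updateInputs p r s v, codeLen N (F (M₀ x.1) x.1.2.1 x.2) ≤
      (N * Real.log 2 + E₁) * (updateInputs p r s v).card) :
    (r : ℝ) / 2 * Real.log t - (t - 1) * r * ((E₀ + Real.log 2) / p) ≤
      E₀ + E₁ + 2 * Real.log 2 := by
  classical
  have hs0 : 0 < s := by omega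
  have hp' : (0 : ℝ) < p := by exact_mod_cast hp
  have hdens := mul_sum_density_differ_le M₀ F ans₀ ans₁ h₀row h₀col h₁row hp hr hs N hN E₀ hE₀
  have hhits := le_sum_hits_differ M₀ F ans₀ ans₁ h₀col h₁col hv
  have hcard := le_card_updateInputs (p := p) (r := r) (v := v) hs
  rw [← hN] at hcard
  set S := updateInputs p r s v with hS
  have hpos : 0 < (S.card : ℝ) := by
    have h1 := disjointInputs_nonempty (v := v) hp hr hs
    rw [hS, updateInputs, Finset.card_product, Nat.cast_mul]
    exact mul_pos h1 (by exact_mod_cast Fintype.card_pos)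
  set D := differ ans₀ ans₁ with hD
  let m₁ : ((RowKeys p r s × (Fin p → Value v)) × (ColKeys p r s × (Fin r → Value v))) ×
    (Fin r → Value v) → List Bool := fun x => F (M₀ x.1) x.1.2.1 x.2
  set I₀ := S.image fun x => M₀ x.1
  set I₁ := S.image m₁
  -- The code weight of the final memories that return the values `V` on the keys `a`.
  let Q : RowKeys p r s → (Fin p → Value v) → ℝ := fun a V =>
    ∑ m ∈ I₁.filter (fun m => (fun i => ans₁ m (a.key i)) = V), Real.exp (-codeLen N m)
  have hQpos : ∀ x ∈ S, 0 < Q x.1.1.1 x.1.1.2 := by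
    intro x hx
    refine Finset.sum_pos (fun _ _ => Real.exp_pos _) ⟨m₁ x, Finset.mem_filter.2
      ⟨Finset.mem_image_of_mem _ hx, ?_⟩⟩
    funext i
    exact h₁row _ _ _ _ _ (not_meets_of_mem hx) i
  have hQsum : ∀ a, ∑ V, Q a V ≤ 1 := by
    intro a
    rw [Finset.sum_fiberwise]
    exact sum_exp_neg_codeLen_le _ _
  -- The values `V` are uniform, so conditioning on them gains `p * v` bits.
  have hQ := sum_le_of_sum_exp_le S (fun x => Real.log (Q x.1.1.1 x.1.1.2))
    (Real.log 2 - p * v * Real.log 2) ?_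
  · have hmain := sum_le_of_sum_exp_le S
      (fun x => -codeLen N (M₀ x.1) + (-codeLen N (m₁ x) - Real.log (Q x.1.1.1 x.1.1.2) +
        (hits x.1.2.1 (D (M₀ x.1) (m₁ x)) * Real.log t -
          (t - 1) * r * density (D (M₀ x.1) (m₁ x)))))
      (Real.log 2 - (N + r * v) * Real.log 2) ?_
    · simp only [Finset.sum_add_distrib, Finset.sum_sub_distrib, Finset.sum_neg_distrib,
        ← Finset.mul_sum, ← Finset.sum_mul] at hmain
      have h1 := mul_le_mul_of_nonneg_right hhits (Real.log_nonneg ht)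
      have h2 : ∑ x ∈ S, density (D (M₀ x.1) (m₁ x)) ≤
          S.card * ((E₀ + Real.log 2) / p) := by
        rw [mul_div_assoc', le_div_iff₀ hp', mul_comm]
        exact hdens
      have h3 := mul_le_mul_of_nonneg_left h2
        (mul_nonneg (by linarith) (Nat.cast_nonneg r) : 0 ≤ (t - 1) * (r : ℝ))
      change ∑ x ∈ S, codeLen N (m₁ x) ≤ _ at hE₁
      change _ ≤ (∑ x ∈ S, (hits x.1.2.1 (D (M₀ x.1) (m₁ x)) : ℝ)) * Real.log t at h1
      refine le_of_mul_le_mul_right (a := (S.card : ℝ)) ?_ hpos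
      have hN' : (N : ℝ) = p * v + r * v := by rw [hN]; push_cast; ring
      have hN'' : (N : ℝ) * Real.log 2 * S.card =
          (p * v + r * v) * Real.log 2 * S.card := by rw [hN']
      linarith
    · let f : (RowKeys p r s × List Bool) × List Bool × ColKeys p r s → ℝ := fun y =>
        Real.exp (-codeLen N y.1.2 + (-codeLen N y.2.1 -
          Real.log (Q y.1.1 fun i => ans₀ y.1.2 (y.1.1.key i)) +
          (hits y.2.2 (D y.1.2 y.2.1) * Real.log t - (t - 1) * r * density (D y.1.2 y.2.1))))
      let u : Finset ((RowKeys p r s × List Bool) × List Bool × ColKeys p r s) :=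
        ((Finset.univ ×ˢ I₀) ×ˢ I₁ ×ˢ Finset.univ).filter fun y =>
          (fun i => ans₁ y.2.1 (y.1.1.key i)) = fun i => ans₀ y.1.2 (y.1.1.key i)
      have hV₀ : ∀ x ∈ S, (fun i => ans₀ (M₀ x.1) (x.1.1.1.key i)) = x.1.1.2 := by
        intro x hx
        funext i
        exact h₀row _ _ _ _ (not_meets_of_mem hx) i
      have h1 := sum_comp_le_of_injOn (s := S) (t := u)
        (fun x => ((x.1.1.1, M₀ x.1), (m₁ x, x.1.2.1))) f ?_ ?_ (fun y _ => (Real.exp_pos _).le)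
      · refine le_trans (le_of_eq ?_) (h1.trans ?_)
        · refine Finset.sum_congr rfl fun x hx => ?_
          simp only [f, hV₀ x hx]
        · have h2 : ∀ (a : RowKeys p r s) (m₀ : List Bool), (∑ m ∈ I₁, ∑ b : ColKeys p r s,
              if (fun i => ans₁ m (a.key i)) = (fun i => ans₀ m₀ (a.key i)) then
                f ((a, m₀), (m, b)) else 0) ≤
              Real.exp (-codeLen N m₀) * Fintype.card (ColKeys p r s) := by
            intro a m₀
            set V := fun i => ans₀ m₀ (a.key i)
            have h3 : ∀ m, (∑ b : ColKeys p r s,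
                if (fun i => ans₁ m (a.key i)) = V then f ((a, m₀), (m, b)) else 0) ≤
                if (fun i => ans₁ m (a.key i)) = V then Real.exp (-codeLen N m₀) *
                  (Real.exp (-codeLen N m) * Real.exp (-Real.log (Q a V))) *
                  Fintype.card (ColKeys p r s) else 0 := by
              intro m
              split_ifs
              · have hf : ∀ b, f ((a, m₀), (m, b)) = Real.exp (-codeLen N m₀) *
                    (Real.exp (-codeLen N m) * Real.exp (-Real.log (Q a V))) *
                    Real.exp (hits b (D m₀ m) * Real.log t -
                      (t - 1) * r * density (D m₀ m)) := by
                  intro b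
                  rw [← Real.exp_add, ← Real.exp_add, ← Real.exp_add]
                  simp only [f]
                  congr 1
                  ring
                simp_rw [hf]
                rw [← Finset.mul_sum]
                gcongr
                exact sum_exp_hits_le hp hr hs0 _ ht
              · simp
            refine (Finset.sum_le_sum fun m _ => h3 m).trans ?_
            rw [← Finset.sum_filter, ← Finset.sum_mul, ← Finset.mul_sum, ← Finset.sum_mul]
            change Real.exp (-codeLen N m₀) * (Q a V * _) * _ ≤ _
            have h4 : Q a V * Real.exp (-Real.log (Q a V)) ≤ 1 := by
              have hQ0 : 0 ≤ Q a V := Finset.sum_nonneg fun _ _ => (Real.exp_pos _).le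
              rcases hQ0.eq_or_lt with h | h
              · rw [← h]; simp
              · rw [Real.exp_neg, Real.exp_log h, mul_inv_cancel₀ h.ne']
            gcongr
            exact mul_le_of_le_one_right (Real.exp_pos _).le h4
          rw [Finset.sum_filter, Finset.sum_product, Finset.sum_product]
          calc _ ≤ ∑ a : RowKeys p r s, (Fintype.card (ColKeys p r s) : ℝ) := by
                refine Finset.sum_le_sum fun a _ => ?_
                calc _ ≤ ∑ m₀ ∈ I₀, Real.exp (-codeLen N m₀) *
                      (Fintype.card (ColKeys p r s) : ℝ) := by
                      refine Finset.sum_le_sum fun m₀ _ => ?_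
                      rw [Finset.sum_product]
                      exact h2 a m₀
                  _ ≤ _ := by
                      rw [← Finset.sum_mul]
                      exact mul_le_of_le_one_left (Nat.cast_nonneg _)
                        (sum_exp_neg_codeLen_le _ _)
            _ ≤ _ := by
                rw [Finset.sum_const, nsmul_eq_mul, Finset.card_univ, Real.exp_sub,
                  Real.exp_log (by norm_num), mul_div_assoc', le_div_iff₀ (Real.exp_pos _),
                  add_mul, Real.exp_add]
                linarith
      · intro x hx
        simp only [u, Finset.mem_filter, Finset.mem_product, Finset.mem_univ, and_true, true_and]
        refine ⟨⟨Finset.mem_image.2 ⟨x, hx, rfl⟩, Finset.mem_image.2 ⟨x, hx, rfl⟩⟩, ?_⟩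
        rw [hV₀ x hx]
        funext i
        exact h₁row _ _ _ _ _ (not_meets_of_mem hx) i
      · intro x hx x' hx' h
        have hm := not_meets_of_mem hx
        have hm' := not_meets_of_mem hx'
        obtain ⟨⟨⟨a, V⟩, b, W⟩, V₁⟩ := x
        obtain ⟨⟨⟨a', V'⟩, b', W'⟩, V₁'⟩ := x'
        simp only [Prod.mk.injEq, m₁] at h
        obtain ⟨⟨rfl, hM⟩, hM', rfl⟩ := h
        have hV : V = V' := by
          funext i; rw [← h₀row a V b W hm i, ← h₀row a V' b W' hm' i, hM]
        have hW : W = W' := by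
          funext j; rw [← h₀col a V b W hm j, ← h₀col a V' b W' hm' j, hM]
        have hV₁ : V₁ = V₁' := by
          funext j; rw [← h₁col a V b W V₁ hm j, ← h₁col a V' b W' V₁' hm' j, hM']
        rw [hV, hW, hV₁]
  · refine le_trans (le_of_eq (Finset.sum_congr rfl fun x hx => Real.exp_log (hQpos x hx))) ?_
    refine (Finset.sum_le_sum_of_subset_of_nonneg (Finset.subset_univ S) fun x _ _ =>
      Finset.sum_nonneg fun _ _ => (Real.exp_pos _).le).trans ?_
    rw [Fintype.sum_prod_type, Fintype.sum_prod_type, Fintype.sum_prod_type]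
    simp only [Finset.sum_const, Finset.card_univ, nsmul_eq_mul, ← Finset.mul_sum]
    calc _ ≤ (Fintype.card (ColKeys p r s × (Fin r → Value v)) : ℝ) *
          (Fintype.card (Fin r → Value v) * ∑ _a : RowKeys p r s, (1 : ℝ)) := by
          gcongr with a _
          exact hQsum a
      _ ≤ _ := by
          rw [Finset.sum_const, nsmul_eq_mul, Finset.card_univ, mul_one, Fintype.card_prod,
            Nat.cast_mul, card_vals, Fintype.card_fin, Real.exp_sub, Real.exp_log (by norm_num),
            mul_div_assoc', le_div_iff₀ (Real.exp_pos _)]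
          have hN' : (N : ℝ) * Real.log 2 = p * v * Real.log 2 + r * v * Real.log 2 := by
            rw [hN]; push_cast; ring
          rw [hN', Real.exp_add] at hcard
          linarith

end Update

end Tradeoffs

/-! ### Short memories are rare -/

section Lengths

variable {p r s v : ℕ}

/-- If the memory determines the input `x` once `k x` is known, and `k` takes few values compared
with the number of inputs, then memories shorter than `N` bits are rare. -/
theorem sum_sub_length_le_of_injOn {ι κ : Type*} [DecidableEq κ] (S : Finset ι) (K : Finset κ)
    (k : ι → κ) (m : ι → List Bool) (N : ℕ) (hk : ∀ x ∈ S, k x ∈ K)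
    (hinj : Set.InjOn (fun x => (k x, m x)) S) (hcard : (K.card : ℝ) * 2 ^ N ≤ S.card) :
    ∑ x ∈ S, ((N - (m x).length : ℕ) : ℝ) ≤ 2 * S.card := by
  have h := sum_comp_le_of_injOn (s := S) (t := K ×ˢ S.image m) (fun x => (k x, m x))
    (fun y => ((N - y.2.length : ℕ) : ℝ))
    (fun x hx => Finset.mem_product.2 ⟨hk x hx, Finset.mem_image_of_mem _ hx⟩) hinj
    (fun _ _ => Nat.cast_nonneg _)
  refine h.trans ?_
  rw [Finset.sum_product]
  dsimp only
  rw [Finset.sum_const, nsmul_eq_mul]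
  have := mul_le_mul_of_nonneg_left (sum_sub_length_le N (S.image m))
    (Nat.cast_nonneg K.card : (0 : ℝ) ≤ K.card)
  linarith

/-- Row and column transversals without common keys. -/
def disjointPairs (p r s : ℕ) : Finset (RowKeys p r s × ColKeys p r s) :=
  Finset.univ.filter fun x => ¬ Meets x.1 x.2

theorem card_disjointInputs :
    ((disjointInputs p r s v).card : ℝ) = (disjointPairs p r s).card * 2 ^ ((p + r) * v) := by
  have h : (disjointInputs p r s v).card = (disjointPairs p r s ×ˢ
      (Finset.univ : Finset ((Fin p → Value v) × (Fin r → Value v)))).card := by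
    refine Finset.card_equiv (Equiv.prodProdProdComm _ _ _ _) fun x => ?_
    simp [disjointInputs, disjointPairs, Equiv.prodProdProdComm]
  rw [h, Finset.card_product, Finset.card_univ, Fintype.card_prod]
  simp only [Fintype.card_fun, Fintype.card_fin, Fintype.card_bool]
  push_cast
  rw [← pow_mul, ← pow_mul, ← pow_add]
  ring

theorem card_updateInputs :
    ((updateInputs p r s v).card : ℝ) =
      (disjointPairs p r s ×ˢ (Finset.univ : Finset (Fin r → Value v))).card *
        2 ^ ((p + r) * v) := by
  rw [updateInputs, Finset.card_product, Finset.card_product]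
  push_cast
  rw [card_disjointInputs]
  ring

end Lengths

/-! ### Operation sequences -/

section Operations

variable {U : Type*} {v : ℕ}

/-- The key that an operation concerns. -/
def Op.key : Op U v → U
  | .insert k _ => k
  | .update k _ => k

/-- The value that an operation assigns. -/
def Op.value : Op U v → Value v
  | .insert _ x => x
  | .update _ x => x

theorem Op.apply_eq [DecidableEq U] (f : Table U v) (o : Op U v) :
    o.apply f = Function.update f o.key (some o.value) := by
  cases o <;> rfl

theorem Table.after_append [DecidableEq U] (f : Table U v) (l₁ l₂ : List (Op U v)) :
    f.after (l₁ ++ l₂) = (f.after l₁).after l₂ :=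
  List.foldl_append

theorem Table.after_of_forall_ne [DecidableEq U] (f : Table U v) (l : List (Op U v)) (k : U)
    (h : ∀ o ∈ l, o.key ≠ k) : f.after l k = f k := by
  induction l generalizing f with
  | nil => rfl
  | cons o l ih =>
    change (o.apply f).after l k = f k
    rw [ih _ fun o' ho' => h o' (List.mem_cons_of_mem _ ho'), Op.apply_eq,
      Function.update_of_ne (h o List.mem_cons_self).symm]

theorem Table.after_of_mem [DecidableEq U] (f : Table U v) (l : List (Op U v))
    (hl : (l.map Op.key).Nodup) {o : Op U v} (ho : o ∈ l) : f.after l o.key = some o.value := by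
  induction l generalizing f with
  | nil => simp at ho
  | cons o' l ih =>
    rw [List.map_cons, List.nodup_cons] at hl
    change (o'.apply f).after l o.key = _
    rcases List.mem_cons.1 ho with rfl | ho
    · rw [Table.after_of_forall_ne _ _ o.key fun o' ho' he =>
          hl.1 (he ▸ List.mem_map_of_mem (f := Op.key) ho'),
        Op.apply_eq, Function.update_self]
    · exact ih _ hl.2 ho

theorem legalFrom_append [Fintype U] [DecidableEq U] (n : ℕ) (f : Table U v)
    (l₁ l₂ : List (Op U v)) :
    LegalFrom n f (l₁ ++ l₂) ↔ LegalFrom n f l₁ ∧ LegalFrom n (f.after l₁) l₂ := by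
  induction l₁ generalizing f with
  | nil => simp [LegalFrom, Table.after]
  | cons o l ih =>
    change _ ∧ LegalFrom n (o.apply f) (l ++ l₂) ↔
      (_ ∧ LegalFrom n (o.apply f) l) ∧ LegalFrom n ((o.apply f).after l) l₂
    rw [ih, and_assoc]

theorem Table.numKeys_apply_le [Fintype U] [DecidableEq U] (f : Table U v) (o : Op U v) :
    (o.apply f).numKeys ≤ f.numKeys + 1 := by
  rw [Op.apply_eq, Table.numKeys, Table.numKeys]
  refine (Finset.card_le_card (t := insert o.key (Finset.univ.filter fun k =>
    (f k).isSome = true)) fun k hk => ?_).trans (Finset.card_insert_le _ _)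
  rw [Finset.mem_insert]
  by_cases h : k = o.key
  · exact Or.inl h
  · simpa [h] using hk

theorem legalFrom_of_insert [Fintype U] [DecidableEq U] (n : ℕ) (f : Table U v)
    (l : List (Op U v)) (hins : ∀ o ∈ l, o = .insert o.key o.value)
    (hl : (l.map Op.key).Nodup) (hf : ∀ o ∈ l, f o.key = none)
    (hn : f.numKeys + l.length ≤ n) : LegalFrom n f l := by
  induction l generalizing f with
  | nil => trivial
  | cons o l ih =>
    rw [List.map_cons, List.nodup_cons] at hl
    rw [List.length_cons] at hn
    refine ⟨?_, ih _ (fun o' ho' => hins o' (List.mem_cons_of_mem _ ho')) hl.2 ?_ ?_⟩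
    · rw [hins o List.mem_cons_self]
      exact ⟨hf o List.mem_cons_self, by omega⟩
    · intro o' ho'
      rw [Op.apply_eq, Function.update_of_ne]
      · exact hf o' (List.mem_cons_of_mem _ ho')
      · intro he
        exact hl.1 (he ▸ List.mem_map_of_mem ho')
    · have := f.numKeys_apply_le o
      omega

theorem legalFrom_of_update [Fintype U] [DecidableEq U] (n : ℕ) (f : Table U v)
    (l : List (Op U v)) (hupd : ∀ o ∈ l, o = .update o.key o.value)
    (hf : ∀ o ∈ l, f o.key ≠ none) : LegalFrom n f l := by
  induction l generalizing f with
  | nil => trivial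
  | cons o l ih =>
    refine ⟨?_, ih _ (fun o' ho' => hupd o' (List.mem_cons_of_mem _ ho')) ?_⟩
    · rw [hupd o List.mem_cons_self]
      exact hf o List.mem_cons_self
    · intro o' ho'
      rw [Op.apply_eq, Function.update_apply]
      split_ifs
      · simp
      · exact hf o' (List.mem_cons_of_mem _ ho')

theorem Program.runFrom_append {Ω : Type*} (D : Program U v Ω) (ω : Ω) (t : ℕ) (m : List Bool)
    (l₁ l₂ : List (Op U v)) :
    D.runFrom ω t m (l₁ ++ l₂) = D.runFrom ω (t + l₁.length) (D.runFrom ω t m l₁) l₂ := by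
  induction l₁ generalizing t m with
  | nil => rfl
  | cons o l ih =>
    change D.runFrom ω (t + 1) (D.step ω t m o) (l ++ l₂) = _
    rw [ih, List.length_cons, show t + 1 + l.length = t + (l.length + 1) by ring]
    rfl

theorem Program.run_append {Ω : Type*} (D : Program U v Ω) (ω : Ω) (l₁ l₂ : List (Op U v)) :
    D.run ω (l₁ ++ l₂) = D.runFrom ω l₁.length (D.run ω l₁) l₂ := by
  rw [Program.run, Program.runFrom_append, Nat.zero_add, Program.run]

instance [Countable U] : Countable (Op U v) := by
  have : Function.Injective fun o : Op U v =>
      (match o with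
        | .insert k x => Sum.inl (k, x)
        | .update k x => Sum.inr (k, x) : (U × Value v) ⊕ (U × Value v)) := by
    rintro (⟨k, x⟩ | ⟨k, x⟩) (⟨k', x'⟩ | ⟨k', x'⟩) h <;> simp_all
  exact this.countable

end Operations

/-! ### Fixing the random source -/

/-- Derandomization: if the expected size is below `T`, then some outcome of the random
source answers all queries correctly and, for two given finite families of legal operation
sequences, has mean sizes that add up to at most `2 * T`. -/
theorem exists_correct_outcome {U : Type*} [Fintype U] [DecidableEq U] {n v : ℕ} {Ω : Type*}
    [MeasurableSpace Ω] {P : Measure Ω} [IsProbabilityMeasure P] (D : IncrementalRetrieval U n v P)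
    {T : ℝ} (hT : 0 ≤ T) (hS : D.expectedSize < ENNReal.ofReal T) {ι κ : Type*} (s : Finset ι)
    (t : Finset κ) (hs : 0 < (s.card : ℝ)) (ht : 0 < (t.card : ℝ)) (o₀ : ι → List (Op U v))
    (o₁ : κ → List (Op U v)) (ho₀ : ∀ i ∈ s, Legal n (o₀ i)) (ho₁ : ∀ i ∈ t, Legal n (o₁ i)) :
    ∃ ω A B, (∀ ops : List (Op U v), Legal n ops → ∀ (k : U) (x : Value v),
        (Table.empty U v).after ops k = some x →
          D.query ω ops.length (D.run ω ops) k = x) ∧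
      ∑ i ∈ s, ((D.run ω (o₀ i)).length : ℝ) ≤ A * s.card ∧
      ∑ i ∈ t, ((D.run ω (o₁ i)).length : ℝ) ≤ B * t.card ∧ A + B ≤ 2 * T := by
  have hae : ∀ᵐ ω ∂P, ∀ ops : List (Op U v), Legal n ops → ∀ (k : U) (x : Value v),
      (Table.empty U v).after ops k = some x → D.query ω ops.length (D.run ω ops) k = x := by
    rw [ae_all_iff]
    intro ops
    by_cases h : Legal n ops
    · filter_upwards [D.correct ops h] with ω hω _ using hω
    · exact Filter.Eventually.of_forall fun ω h' => (h h').elim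
  have hsize : ∀ ops, Legal n ops → ∫⁻ ω, (D.size ω ops : ℝ≥0∞) ∂P ≤ ENNReal.ofReal T := by
    intro ops h
    refine le_trans ?_ hS.le
    exact le_iSup₂ (f := fun (ops : List (Op U v)) (_ : Legal n ops) =>
      ∫⁻ ω, (D.size ω ops : ℝ≥0∞) ∂P) ops h
  have hmeas : ∀ ops, Legal n ops → Measurable fun ω => (D.size ω ops : ℝ≥0∞) := fun ops h =>
    (measurable_from_top (f := fun k : ℕ => (k : ℝ≥0∞))).comp (D.measurable_size ops h)
  set f : Ω → ℝ≥0∞ := fun ω => t.card * (∑ i ∈ s, (D.size ω (o₀ i) : ℝ≥0∞)) +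
    s.card * ∑ i ∈ t, (D.size ω (o₁ i) : ℝ≥0∞) with hf
  have hm₀ : Measurable fun ω => ∑ i ∈ s, (D.size ω (o₀ i) : ℝ≥0∞) :=
    Finset.measurable_sum _ fun i hi => hmeas _ (ho₀ i hi)
  have hm₁ : Measurable fun ω => ∑ i ∈ t, (D.size ω (o₁ i) : ℝ≥0∞) :=
    Finset.measurable_sum _ fun i hi => hmeas _ (ho₁ i hi)
  have hfm : Measurable f := (hm₀.const_mul _).add (hm₁.const_mul _)
  have hint : ∫⁻ ω, f ω ∂P ≤ ENNReal.ofReal (2 * T * s.card * t.card) := by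
    rw [hf, lintegral_add_left (hm₀.const_mul _), lintegral_const_mul _ hm₀,
      lintegral_const_mul _ hm₁, lintegral_finsetSum' _ fun i hi => (hmeas _ (ho₀ i hi)).aemeasurable,
      lintegral_finsetSum' _ fun i hi => (hmeas _ (ho₁ i hi)).aemeasurable]
    have h0 := Finset.sum_le_card_nsmul s (fun i => ∫⁻ ω, (D.size ω (o₀ i) : ℝ≥0∞) ∂P) _
      fun i hi => hsize _ (ho₀ i hi)
    have h1 := Finset.sum_le_card_nsmul t (fun i => ∫⁻ ω, (D.size ω (o₁ i) : ℝ≥0∞) ∂P) _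
      fun i hi => hsize _ (ho₁ i hi)
    rw [nsmul_eq_mul] at h0 h1
    calc _ ≤ (t.card : ℝ≥0∞) * (s.card * ENNReal.ofReal T) +
          s.card * (t.card * ENNReal.ofReal T) := by gcongr
      _ = 2 * ENNReal.ofReal T * s.card * t.card := by ring
      _ = _ := by
        rw [ENNReal.ofReal_mul (by positivity), ENNReal.ofReal_mul (by positivity),
          ENNReal.ofReal_mul (by positivity), ENNReal.ofReal_natCast, ENNReal.ofReal_natCast,
          ENNReal.ofReal_ofNat]
  obtain ⟨ω, hω, hle⟩ := exists_notMem_null_le_lintegral hfm.aemeasurable (ae_iff.1 hae)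
  have hle' := hle.trans hint
  refine ⟨ω, (∑ i ∈ s, ((D.run ω (o₀ i)).length : ℝ)) / s.card,
    (∑ i ∈ t, ((D.run ω (o₁ i)).length : ℝ)) / t.card, not_not.1 hω, ?_, ?_, ?_⟩
  · rw [div_mul_cancel₀ _ hs.ne']
  · rw [div_mul_cancel₀ _ ht.ne']
  · have hcast : f ω = ENNReal.ofReal (t.card * (∑ i ∈ s, ((D.run ω (o₀ i)).length : ℝ)) +
        s.card * ∑ i ∈ t, ((D.run ω (o₁ i)).length : ℝ)) := by
      have : (t.card * (∑ i ∈ s, ((D.run ω (o₀ i)).length : ℝ)) +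
        s.card * ∑ i ∈ t, ((D.run ω (o₁ i)).length : ℝ)) =
        ((t.card * (∑ i ∈ s, (D.run ω (o₀ i)).length) +
        s.card * ∑ i ∈ t, (D.run ω (o₁ i)).length : ℕ) : ℝ) := by push_cast; rfl
      rw [this, ENNReal.ofReal_natCast]
      push_cast
      rfl
    rw [hcast, ENNReal.ofReal_le_ofReal_iff (by positivity)] at hle'
    rw [div_add_div _ _ hs.ne' ht.ne', div_le_iff₀ (mul_pos hs ht)]
    linarith

/-! ### The two batches of insertions and the updates -/

section Sequences

variable {U : Type*} {p r s v : ℕ}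

/-- Insertion of the keys of a row transversal. -/
def rowInserts (φ : Point p r s ↪ U) (a : RowKeys p r s) (V : Fin p → Value v) :
    List (Op U v) :=
  List.ofFn fun i => Op.insert (φ (a.key i)) (V i)

/-- Insertion of the keys of a column transversal. -/
def colInserts (φ : Point p r s ↪ U) (b : ColKeys p r s) (W : Fin r → Value v) :
    List (Op U v) :=
  List.ofFn fun j => Op.insert (φ (b.key j)) (W j)

/-- Updates of the keys of a column transversal. -/
def colUpdates (φ : Point p r s ↪ U) (b : ColKeys p r s) (W : Fin r → Value v) :
    List (Op U v) :=
  List.ofFn fun j => Op.update (φ (b.key j)) (W j)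

variable (φ : Point p r s ↪ U) (a : RowKeys p r s) (b : ColKeys p r s)
  (V : Fin p → Value v) (W V₁ : Fin r → Value v)

@[simp]
theorem length_rowInserts : (rowInserts φ a V).length = p := List.length_ofFn

@[simp]
theorem length_colInserts : (colInserts φ b W).length = r := List.length_ofFn

@[simp]
theorem length_colUpdates : (colUpdates φ b W).length = r := List.length_ofFn

theorem nodup_rowInserts : ((rowInserts φ a V).map Op.key).Nodup := by
  rw [rowInserts, List.map_ofFn, List.nodup_ofFn]
  exact φ.injective.comp a.key_injective

theorem nodup_colInserts : ((colInserts φ b W).map Op.key).Nodup := by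
  rw [colInserts, List.map_ofFn, List.nodup_ofFn]
  exact φ.injective.comp b.key_injective

theorem nodup_colUpdates : ((colUpdates φ b W).map Op.key).Nodup := by
  rw [colUpdates, List.map_ofFn, List.nodup_ofFn]
  exact φ.injective.comp b.key_injective

variable {a b} in
theorem nodup_inserts (hm : ¬ Meets a b) :
    ((rowInserts φ a V ++ colInserts φ b W).map Op.key).Nodup := by
  rw [List.map_append, List.nodup_append']
  refine ⟨nodup_rowInserts φ a V, nodup_colInserts φ b W, ?_⟩
  rw [rowInserts, colInserts, List.map_ofFn, List.map_ofFn, List.disjoint_left]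
  simp only [List.mem_ofFn, forall_exists_index]
  rintro _ i rfl ⟨j, hj⟩
  exact RowKeys.key_ne_key hm i j (φ.injective hj.symm)

variable [DecidableEq U]

theorem legal_rowInserts [Fintype U] {n : ℕ} (hn : p ≤ n) : Legal n (rowInserts φ a V) := by
  refine legalFrom_of_insert _ _ _ ?_ (nodup_rowInserts φ a V) (fun _ _ => rfl) ?_
  · simp only [rowInserts, List.forall_mem_ofFn_iff]
    exact fun i => rfl
  · simpa [Table.numKeys, Table.empty] using hn

variable {a b} in
theorem legal_inserts [Fintype U] (hm : ¬ Meets a b) {n : ℕ} (hn : p + r ≤ n) :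
    Legal n (rowInserts φ a V ++ colInserts φ b W) := by
  refine legalFrom_of_insert _ _ _ ?_ (nodup_inserts φ V W hm) (fun _ _ => rfl) ?_
  · intro o ho
    rcases List.mem_append.1 ho with ho | ho
    · obtain ⟨i, rfl⟩ := List.mem_ofFn.1 ho; rfl
    · obtain ⟨j, rfl⟩ := List.mem_ofFn.1 ho; rfl
  · simpa [Table.numKeys, Table.empty] using hn

theorem after_rowInserts (i : Fin p) :
    (Table.empty U v).after (rowInserts φ a V) (φ (a.key i)) = some (V i) :=
  Table.after_of_mem _ _ (nodup_rowInserts φ a V) (List.mem_ofFn.2 ⟨i, rfl⟩)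

variable {a b} in
theorem after_inserts_row (hm : ¬ Meets a b) (i : Fin p) :
    (Table.empty U v).after (rowInserts φ a V ++ colInserts φ b W) (φ (a.key i)) = some (V i) :=
  Table.after_of_mem _ _ (nodup_inserts φ V W hm)
    (List.mem_append_left _ (List.mem_ofFn.2 ⟨i, rfl⟩))

variable {a b} in
theorem after_inserts_col (hm : ¬ Meets a b) (j : Fin r) :
    (Table.empty U v).after (rowInserts φ a V ++ colInserts φ b W) (φ (b.key j)) = some (W j) :=
  Table.after_of_mem _ _ (nodup_inserts φ V W hm)
    (List.mem_append_right _ (List.mem_ofFn.2 ⟨j, rfl⟩))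

variable {a b} in
theorem legal_updates [Fintype U] (hm : ¬ Meets a b) {n : ℕ} (hn : p + r ≤ n) :
    Legal n ((rowInserts φ a V ++ colInserts φ b W) ++ colUpdates φ b V₁) := by
  refine (legalFrom_append _ _ _ _).2 ⟨legal_inserts φ V W hm hn, ?_⟩
  refine legalFrom_of_update _ _ _ ?_ ?_
  · simp only [colUpdates, List.forall_mem_ofFn_iff]
    exact fun i => rfl
  · simp only [colUpdates, List.forall_mem_ofFn_iff]
    intro j
    change (Table.empty U v).after _ (φ (b.key j)) ≠ none
    rw [after_inserts_col φ V W hm j]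
    simp

variable {a b} in
theorem after_updates_row (hm : ¬ Meets a b) (i : Fin p) :
    (Table.empty U v).after ((rowInserts φ a V ++ colInserts φ b W) ++ colUpdates φ b V₁)
      (φ (a.key i)) = some (V i) := by
  rw [Table.after_append, Table.after_of_forall_ne, after_inserts_row φ V W hm i]
  simp only [colUpdates, List.forall_mem_ofFn_iff]
  exact fun j hj => RowKeys.key_ne_key hm i j (φ.injective hj.symm)

theorem after_updates_col (j : Fin r) :
    (Table.empty U v).after ((rowInserts φ a V ++ colInserts φ b W) ++ colUpdates φ b V₁)
      (φ (b.key j)) = some (V₁ j) := by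
  rw [Table.after_append]
  exact Table.after_of_mem _ _ (nodup_colUpdates φ b V₁) (List.mem_ofFn.2 ⟨j, rfl⟩)

end Sequences

theorem sub_two_le_of_sum {ι : Type*} (S : Finset ι) (hS : 0 < (S.card : ℝ)) (m : ι → List Bool)
    (N : ℕ) (A : ℝ) (hshort : ∑ x ∈ S, ((N - (m x).length : ℕ) : ℝ) ≤ 2 * S.card)
    (hA : ∑ x ∈ S, ((m x).length : ℝ) ≤ A * S.card) : (N : ℝ) - 2 ≤ A := by
  have h : ∑ x ∈ S, ((N : ℝ) - (m x).length) ≤ ∑ x ∈ S, ((N - (m x).length : ℕ) : ℝ) := by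
    refine Finset.sum_le_sum fun x _ => ?_
    rw [sub_le_iff_le_add]
    exact_mod_cast (by omega : N ≤ N - (m x).length + (m x).length)
  rw [Finset.sum_sub_distrib, Finset.sum_const, nsmul_eq_mul] at h
  refine le_of_mul_le_mul_right (a := (S.card : ℝ)) ?_ hS
  linarith

theorem exists_point_embedding {U : Type*} [Fintype U] {p r s : ℕ}
    (h : p * (r * s) ≤ Fintype.card U) : Nonempty (Point p r s ↪ U) :=
  Function.Embedding.nonempty_of_card_le (by simpa using h)

/-! ### The tradeoffs for a retrieval data structure -/

section Bounds

variable {U : Type*} [Fintype U] [DecidableEq U] {n v : ℕ} {Ω : Type*} [MeasurableSpace Ω]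
  {P : Measure Ω} [IsProbabilityMeasure P] (D : IncrementalRetrieval U n v P)

/-- The update tradeoff for a fixed outcome of the random source; `A` and `B` are the mean lengths of
the memories before and after the updates. -/
theorem exists_update_tradeoff {p r s : ℕ} (hp : 0 < p) (hr : 0 < r) (hs : 2 ≤ s) (hv : 1 ≤ v)
    (hn : p + r = n) (φ : Point p r s ↪ U) {T : ℝ} (hT : 0 ≤ T)
    (hS : D.expectedSize < ENNReal.ofReal T) {t : ℝ} (ht : 1 ≤ t) :
    ∃ A B : ℝ, A + B ≤ 2 * T ∧ (n * v : ℝ) - 2 ≤ A ∧ (n * v : ℝ) - 2 ≤ B ∧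
      (r : ℝ) / 2 * Real.log t -
        (t - 1) * r * ((2 * Real.log 2 * (A - n * v) + 4 + Real.log 2) / p) ≤
      (2 * Real.log 2 * (A - n * v) + 4) + (2 * Real.log 2 * (B - n * v) + 4) +
        2 * Real.log 2 := by
  classical
  set S := updateInputs p r s v with hSdef
  have hpos : 0 < (S.card : ℝ) := by
    have h1 := disjointInputs_nonempty (v := v) hp hr hs
    rw [hSdef, updateInputs, Finset.card_product, Nat.cast_mul]
    exact mul_pos h1 (by exact_mod_cast Fintype.card_pos)
  obtain ⟨ω, A, B, hcorr, hA, hB, hAB⟩ := exists_correct_outcome D hT hS S S hpos hpos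
    (fun x => rowInserts φ x.1.1.1 x.1.1.2 ++ colInserts φ x.1.2.1 x.1.2.2)
    (fun x => (rowInserts φ x.1.1.1 x.1.1.2 ++ colInserts φ x.1.2.1 x.1.2.2) ++
      colUpdates φ x.1.2.1 x.2)
    (fun x hx => legal_inserts φ _ _ (not_meets_of_mem hx) hn.le)
    (fun x hx => legal_updates φ _ _ _ (not_meets_of_mem hx) hn.le)
  set M₀ : (RowKeys p r s × (Fin p → Value v)) × (ColKeys p r s × (Fin r → Value v)) → List Bool :=
    fun y => D.run ω (rowInserts φ y.1.1 y.1.2 ++ colInserts φ y.2.1 y.2.2) with hM₀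
  set F : List Bool → ColKeys p r s → (Fin r → Value v) → List Bool :=
    fun m b V₁ => D.runFrom ω n m (colUpdates φ b V₁) with hF
  have hM₁ : ∀ a V b W V₁, F (M₀ ((a, V), (b, W))) b V₁ =
      D.run ω ((rowInserts φ a V ++ colInserts φ b W) ++ colUpdates φ b V₁) := by
    intro a V b W V₁
    rw [Program.run_append, List.length_append, length_rowInserts, length_colInserts, hn]
  set ans₀ : List Bool → Point p r s → Value v := fun m x => D.query ω n m (φ x) with hans₀
  set ans₁ : List Bool → Point p r s → Value v := fun m x => D.query ω (n + r) m (φ x) with hans₁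
  have h₀row : ∀ a V b W, ¬ Meets a b → ∀ i, ans₀ (M₀ ((a, V), (b, W))) (a.key i) = V i := by
    intro a V b W hm i
    have h := hcorr _ (legal_inserts φ V W hm hn.le) _ _ (after_inserts_row φ V W hm i)
    simpa [hn] using h
  have h₀col : ∀ a V b W, ¬ Meets a b → ∀ j, ans₀ (M₀ ((a, V), (b, W))) (b.key j) = W j := by
    intro a V b W hm j
    have h := hcorr _ (legal_inserts φ V W hm hn.le) _ _ (after_inserts_col φ V W hm j)
    simpa [hn] using h
  have h₁row : ∀ a V b W V₁, ¬ Meets a b → ∀ i,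
      ans₁ (F (M₀ ((a, V), (b, W))) b V₁) (a.key i) = V i := by
    intro a V b W V₁ hm i
    have h := hcorr _ (legal_updates φ V W V₁ hm hn.le) _ _ (after_updates_row φ V W V₁ hm i)
    rw [← hM₁, List.length_append, List.length_append, length_rowInserts, length_colInserts,
      length_colUpdates, hn] at h
    exact h
  have h₁col : ∀ a V b W V₁, ¬ Meets a b → ∀ j,
      ans₁ (F (M₀ ((a, V), (b, W))) b V₁) (b.key j) = V₁ j := by
    intro a V b W V₁ hm j
    have h := hcorr _ (legal_updates φ V W V₁ hm hn.le) _ _ (after_updates_col φ a b V W V₁ j)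
    rw [← hM₁, List.length_append, List.length_append, length_rowInserts, length_colInserts,
      length_colUpdates, hn] at h
    exact h
  set N := (p + r) * v with hN
  have hNn : (N : ℝ) = n * v := by rw [hN, hn]; push_cast; ring
  have hA' : ∑ x ∈ S, ((M₀ x.1).length : ℝ) ≤ A * S.card := hA
  have hB' : ∑ x ∈ S, ((F (M₀ x.1) x.1.2.1 x.2).length : ℝ) ≤ B * S.card := by
    refine le_of_eq_of_le (Finset.sum_congr rfl fun x _ => ?_) hB
    rw [← hM₁]
  set K := disjointPairs p r s ×ˢ (Finset.univ : Finset (Fin r → Value v)) with hK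
  have hKcard : (K.card : ℝ) * 2 ^ N ≤ S.card := by rw [hSdef, card_updateInputs]
  have hmemK : ∀ x ∈ S, ∀ V : Fin r → Value v, ((x.1.1.1, x.1.2.1), V) ∈ K := by
    intro x hx V
    simp only [hK, disjointPairs, Finset.mem_product, Finset.mem_filter, Finset.mem_univ,
      true_and, and_true]
    exact not_meets_of_mem hx
  have hshort₀ := sum_sub_length_le_of_injOn S K (fun x => ((x.1.1.1, x.1.2.1), x.2))
    (fun x => M₀ x.1) N (fun x hx => hmemK x hx _) (by
      intro x hx x' hx' h
      have hm := not_meets_of_mem hx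
      have hm' := not_meets_of_mem hx'
      obtain ⟨⟨⟨a, V⟩, b, W⟩, V₁⟩ := x
      obtain ⟨⟨⟨a', V'⟩, b', W'⟩, V₁'⟩ := x'
      simp only [Prod.mk.injEq] at h
      obtain ⟨⟨⟨rfl, rfl⟩, rfl⟩, hM⟩ := h
      have hV : V = V' := by
        funext i; rw [← h₀row a V b W hm i, ← h₀row a V' b W' hm' i, hM]
      have hW : W = W' := by
        funext j; rw [← h₀col a V b W hm j, ← h₀col a V' b W' hm' j, hM]
      rw [hV, hW]) hKcard
  have hshort₁ := sum_sub_length_le_of_injOn S K (fun x => ((x.1.1.1, x.1.2.1), x.1.2.2))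
    (fun x => F (M₀ x.1) x.1.2.1 x.2) N (fun x hx => hmemK x hx _) (by
      intro x hx x' hx' h
      have hm := not_meets_of_mem hx
      have hm' := not_meets_of_mem hx'
      obtain ⟨⟨⟨a, V⟩, b, W⟩, V₁⟩ := x
      obtain ⟨⟨⟨a', V'⟩, b', W'⟩, V₁'⟩ := x'
      simp only [Prod.mk.injEq] at h
      obtain ⟨⟨⟨rfl, rfl⟩, rfl⟩, hM⟩ := h
      have hV : V = V' := by
        funext i; rw [← h₁row a V b W V₁ hm i, ← h₁row a V' b W V₁' hm' i, hM]
      have hW : V₁ = V₁' := by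
        funext j; rw [← h₁col a V b W V₁ hm j, ← h₁col a V' b W V₁' hm' j, hM]
      rw [hV, hW]) hKcard
  refine ⟨A, B, hAB, ?_, ?_, ?_⟩
  · rw [← hNn]; exact sub_two_le_of_sum S hpos _ N A hshort₀ hA'
  · rw [← hNn]; exact sub_two_le_of_sum S hpos _ N B hshort₁ hB'
  · rw [← hNn]
    exact update_tradeoff M₀ F ans₀ ans₁ h₀row h₀col h₁row h₁col hp hr hs hv ht N rfl _ _
      (sum_codeLen_le S _ N A hshort₀ hA') (sum_codeLen_le S _ N B hshort₁ hB')

/-- The insertion tradeoff for a fixed outcome of the random source; `A` and `B` are the mean lengths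
of the memories after the first and the second batch. -/
theorem exists_insertion_tradeoff {p r s : ℕ} (hp : 0 < p) (hr : 0 < r) (hs : 2 ≤ s) (hv : 1 ≤ v)
    (hn : p + r = n) (φ : Point p r s ↪ U) {T : ℝ} (hT : 0 ≤ T)
    (hS : D.expectedSize < ENNReal.ofReal T) {t : ℝ} (ht : 1 ≤ t) :
    ∃ A B : ℝ, A + B ≤ 2 * T ∧ (p * v : ℝ) - 2 ≤ A ∧ (n * v : ℝ) - 2 ≤ B ∧
      (1 / (s : ℝ) ≤ Real.exp (-(2 * Real.log 2 * (A - p * v) + 4) / p) →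
      (r : ℝ) / 2 * (Real.exp (-(2 * Real.log 2 * (A - p * v) + 4) / p) - 1 / s) * Real.log t -
        (t - 1) * r * (2 / s) ≤ 2 * Real.log 2 * (B - n * v) + 4 + Real.log 2) := by
  classical
  set S := disjointInputs p r s v with hSdef
  have hpos : 0 < (S.card : ℝ) := disjointInputs_nonempty hp hr hs
  set S₀ : Finset (RowKeys p r s × (Fin p → Value v)) := Finset.univ with hS₀
  have hpos₀ : 0 < (S₀.card : ℝ) := by
    have : Nonempty (Fin r) := ⟨⟨0, hr⟩⟩
    have : Nonempty (Fin s) := ⟨⟨0, by omega⟩⟩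
    rw [hS₀, Finset.card_univ]
    exact_mod_cast Fintype.card_pos
  obtain ⟨ω, A, B, hcorr, hA, hB, hAB⟩ := exists_correct_outcome D hT hS S₀ S hpos₀ hpos
    (fun y => rowInserts φ y.1 y.2)
    (fun x => rowInserts φ x.1.1 x.1.2 ++ colInserts φ x.2.1 x.2.2)
    (fun y _ => legal_rowInserts φ _ _ (by omega))
    (fun x hx => legal_inserts φ _ _ (Finset.mem_filter.1 hx).2 hn.le)
  set M₀ : RowKeys p r s → (Fin p → Value v) → List Bool :=
    fun a V => D.run ω (rowInserts φ a V) with hM₀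
  set F : List Bool → ColKeys p r s → (Fin r → Value v) → List Bool :=
    fun m b V₁ => D.runFrom ω p m (colInserts φ b V₁) with hF
  have hM₁ : ∀ a V b V₁, F (M₀ a V) b V₁ =
      D.run ω (rowInserts φ a V ++ colInserts φ b V₁) := by
    intro a V b V₁
    rw [Program.run_append, length_rowInserts]
  set ans₀ : List Bool → Point p r s → Value v := fun m x => D.query ω p m (φ x) with hans₀
  set ans₁ : List Bool → Point p r s → Value v := fun m x => D.query ω n m (φ x) with hans₁
  have h₀ : ∀ a V i, ans₀ (M₀ a V) (a.key i) = V i := by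
    intro a V i
    have h := hcorr _ (legal_rowInserts φ a V (by omega)) _ _ (after_rowInserts φ a V i)
    simpa using h
  have h₁row : ∀ a b V V₁, ¬ Meets a b → ∀ i, ans₁ (F (M₀ a V) b V₁) (a.key i) = V i := by
    intro a b V V₁ hm i
    have h := hcorr _ (legal_inserts φ V V₁ hm hn.le) _ _ (after_inserts_row φ V V₁ hm i)
    rw [← hM₁, List.length_append, length_rowInserts, length_colInserts, hn] at h
    exact h
  have h₁col : ∀ a b V V₁, ¬ Meets a b → ∀ j, ans₁ (F (M₀ a V) b V₁) (b.key j) = V₁ j := by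
    intro a b V V₁ hm j
    have h := hcorr _ (legal_inserts φ V V₁ hm hn.le) _ _ (after_inserts_col φ V V₁ hm j)
    rw [← hM₁, List.length_append, length_rowInserts, length_colInserts, hn] at h
    exact h
  set N₀ := p * v with hN₀
  set N₁ := (p + r) * v with hN₁
  have hNn₀ : (N₀ : ℝ) = p * v := by rw [hN₀]; push_cast; ring
  have hNn₁ : (N₁ : ℝ) = n * v := by rw [hN₁, hn]; push_cast; ring
  have hA' : ∑ x ∈ S₀, ((M₀ x.1 x.2).length : ℝ) ≤ A * S₀.card := hA
  have hB' : ∑ x ∈ S, ((F (M₀ x.1.1 x.1.2) x.2.1 x.2.2).length : ℝ) ≤ B * S.card := by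
    refine le_of_eq_of_le (Finset.sum_congr rfl fun x _ => ?_) hB
    rw [← hM₁]
  have hshort₀ := sum_sub_length_le_of_injOn S₀ (Finset.univ : Finset (RowKeys p r s))
    (fun x => x.1) (fun x => M₀ x.1 x.2) N₀ (fun x _ => Finset.mem_univ _) (by
      rintro ⟨a, V⟩ _ ⟨a', V'⟩ _ h
      simp only [Prod.mk.injEq] at h
      obtain ⟨rfl, hM⟩ := h
      have hV : V = V' := by
        funext i; rw [← h₀ a V i, ← h₀ a V' i, hM]
      rw [hV]) (by
      rw [hS₀, Finset.card_univ, Finset.card_univ, Fintype.card_prod]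
      simp only [Fintype.card_fun, Fintype.card_fin, Fintype.card_bool]
      push_cast
      rw [hN₀, ← pow_mul, mul_comm v])
  have hshort₁ := sum_sub_length_le_of_injOn S (disjointPairs p r s) (fun x => (x.1.1, x.2.1))
    (fun x => F (M₀ x.1.1 x.1.2) x.2.1 x.2.2) N₁
    (fun x hx => Finset.mem_filter.2 ⟨Finset.mem_univ _, (Finset.mem_filter.1 hx).2⟩) (by
      intro x hx x' hx' h
      have hm : ¬ Meets x.1.1 x.2.1 := (Finset.mem_filter.1 hx).2
      have hm' : ¬ Meets x'.1.1 x'.2.1 := (Finset.mem_filter.1 hx').2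
      obtain ⟨⟨a, V⟩, b, W⟩ := x
      obtain ⟨⟨a', V'⟩, b', W'⟩ := x'
      simp only [Prod.mk.injEq] at h
      obtain ⟨⟨rfl, rfl⟩, hM⟩ := h
      have hV : V = V' := by
        funext i; rw [← h₁row a b V W hm i, ← h₁row a b V' W' hm' i, hM]
      have hW : W = W' := by
        funext j; rw [← h₁col a b V W hm j, ← h₁col a b V' W' hm' j, hM]
      rw [hV, hW]) (by rw [hSdef, card_disjointInputs])
  refine ⟨A, B, hAB, ?_, ?_, fun hE => ?_⟩
  · rw [← hNn₀]; exact sub_two_le_of_sum S₀ hpos₀ _ N₀ A hshort₀ hA'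
  · rw [← hNn₁]; exact sub_two_le_of_sum S hpos _ N₁ B hshort₁ hB'
  · rw [← hNn₀] at hE ⊢
    rw [← hNn₁]
    exact insertion_tradeoff M₀ F ans₀ ans₁ h₀ h₁row h₁col hp hr hs hv ht N₀ N₁ rfl rfl _ _
      (by have := sum_codeLen_le S₀ _ N₀ A hshort₀ hA'
          rwa [hS₀, Finset.card_univ] at this)
      (sum_codeLen_le S _ N₁ B hshort₁ hB') hE

end Bounds

/-! ### Numerical estimates -/

theorem exists_fourth_root {L : ℝ} (hL : 2 ^ 20 ≤ L) : ∃ y : ℝ, 32 ≤ y ∧ y ^ 4 = L := by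
  have hL0 : 0 ≤ L := le_trans (by norm_num) hL
  refine ⟨L ^ (1 / 4 : ℝ), ?_, ?_⟩
  · calc (32 : ℝ) = ((2 ^ 20 : ℝ)) ^ (1 / 4 : ℝ) := by
          rw [show (2 : ℝ) ^ 20 = 32 ^ (4 : ℝ) by norm_num, ← Real.rpow_mul (by norm_num)]
          norm_num
      _ ≤ _ := Real.rpow_le_rpow (by norm_num) hL (by norm_num)
  · rw [← Real.rpow_natCast, ← Real.rpow_mul hL0]
    norm_num

theorem le_of_log_eq {x z : ℝ} (hx : 0 < x) (h : Real.log x = Real.log 2 * z) : z ≤ x := by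
  have hl := Real.log_two_gt_d9
  have hle : Real.log x ≤ Real.log 2 * x := by
    have h1 : Real.log (x / 2) ≤ x / 2 - 1 := Real.log_le_sub_one_of_pos (by positivity)
    rw [Real.log_div hx.ne' (by norm_num)] at h1
    have h2 := Real.log_two_lt_d9
    have h3 : (0.69 : ℝ) * x ≤ Real.log 2 * x := by gcongr; linarith
    linarith
  rw [h] at hle
  exact le_of_mul_le_mul_left hle (by linarith)

/-- The density of possible keys is at least of order `L ^ (-1/4) = 1 / y`. -/
theorem one_div_le_exp_neg_div {n p y R e : ℝ} (hn : 1000 ≤ n) (hy : 1 ≤ y) (hp : n / 2 ≤ p)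
    (hR : R ≤ n * (29 / 5 * Real.log y) / 50) (he : e ≤ 14 / 5 * R + n) :
    1 / (8 * y) ≤ Real.exp (-e / p) := by
  have hy0 : 0 < y := by linarith
  have hlogy : 0 ≤ Real.log y := Real.log_nonneg hy
  have h1 : -(Real.log y + 2) ≤ -e / p := by
    rw [le_div_iff₀ (by linarith)]
    have h3 : n / 2 * (Real.log y + 2) ≤ p * (Real.log y + 2) := by gcongr
    have h4 : 0 ≤ n * Real.log y := mul_nonneg (by linarith) hlogy
    linarith
  refine le_trans ?_ (Real.exp_le_exp.2 h1)
  rw [Real.exp_neg, Real.exp_add, Real.exp_log hy0, one_div]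
  have h5 : Real.exp 2 ≤ 8 := by
    have h6 := Real.exp_one_lt_d9
    have h7 : Real.exp 2 = Real.exp 1 * Real.exp 1 := by rw [← Real.exp_add]; norm_num
    rw [h7]
    calc _ ≤ (2.72 : ℝ) * 2.72 := by gcongr <;> linarith
      _ ≤ 8 := by norm_num
  apply inv_anti₀ (by positivity)
  rw [mul_comm 8]
  gcongr

/-- The insertion tradeoff with `t = √n` fails if the redundancy is `n log₂ L / 50`, where
`L = y ^ 4` is the quotient of `log₂ n` and `v`: the gain is of order `n * y ^ 3`, and all costs are
of order `n * y`. -/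
theorem not_insertion_tradeoff {n v r p y R A B : ℝ} (hn : 1000 ≤ n) (hv : 1 ≤ v) (hy : 32 ≤ y)
    (hyvn : y ^ 4 * v ≤ n) (hlogn : Real.log n = Real.log 2 * (y ^ 4 * v)) (hr : 0 ≤ r)
    (hrn : r * 2 ≤ n) (hpr : p + r = n) (hrv : r * v ≤ n / 2) (hrv' : n ≤ 4 * (r * v))
    (hR : R = 4 * Real.log y / Real.log 2) (hAB : A + B ≤ 2 * (n * v + n * R / 50))
    (hA : p * v - 2 ≤ A) (hB : n * v - 2 ≤ B)
    (h : 1 / n ≤ Real.exp (-(2 * Real.log 2 * (A - p * v) + 4) / p) →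
      r / 2 * (Real.exp (-(2 * Real.log 2 * (A - p * v) + 4) / p) - 1 / n) * Real.log √n -
        (√n - 1) * r * (2 / n) ≤ 2 * Real.log 2 * (B - n * v) + 4 + Real.log 2) : False := by
  have hl := Real.log_two_gt_d9
  have hl' := Real.log_two_lt_d9
  set l := Real.log 2
  have hn0 : 0 < n := by linarith
  have hy0 : 0 < y := by linarith
  have hlogy : 0 ≤ Real.log y := Real.log_nonneg (by linarith)
  have hlogy' : Real.log y ≤ y := (Real.log_le_sub_one_of_pos hy0).trans (by linarith)
  have hR0 : 0 ≤ R := by rw [hR]; positivity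
  have hRle : R ≤ 29 / 5 * Real.log y := by
    rw [hR, div_le_iff₀ (by linarith)]
    calc 4 * Real.log y ≤ 29 / 5 * Real.log y * 0.69 := by linarith
      _ ≤ _ := by gcongr; linarith
  have hRn : n * R / 50 ≤ n * (29 / 5 * Real.log y) / 50 := by gcongr
  have hRny : n * R / 50 ≤ n * (29 / 5 * y) / 50 := by gcongr; linarith
  have hRn0 : 0 ≤ n * R / 50 := by positivity
  have hpv : n * v = p * v + r * v := by rw [← hpr]; ring
  have hE : ∀ C : ℝ, C ≤ 2 * (n * R / 50) + n / 2 + 2 →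
      2 * l * C + 4 ≤ 14 / 5 * (n * R / 50) + n := by
    intro C hC
    have hX : 0 ≤ 2 * (n * R / 50) + n / 2 + 2 := by positivity
    have h1 : 2 * l * C ≤ 2 * (7 / 10) * (2 * (n * R / 50) + n / 2 + 2) := by
      calc 2 * l * C ≤ 2 * l * (2 * (n * R / 50) + n / 2 + 2) := by gcongr
        _ ≤ _ := by gcongr; linarith
    linarith
  have hE₁ := hE (B - n * v) (by linarith)
  have hθ := one_div_le_exp_neg_div hn (by linarith) (by linarith : n / 2 ≤ p) hRn
    (hE (A - p * v) (by linarith))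
  set θ := Real.exp (-(2 * l * (A - p * v) + 4) / p)
  have h16y : 16 * y ≤ n := by
    have h3 : (16 : ℝ) ≤ y ^ 3 := (by norm_num : (16 : ℝ) ≤ 32 ^ 3).trans (by gcongr)
    calc 16 * y ≤ y ^ 3 * y := by gcongr
      _ = y ^ 4 * 1 := by ring
      _ ≤ y ^ 4 * v := by gcongr
      _ ≤ n := hyvn
  have hsmall : 1 / n ≤ 1 / (16 * y) := one_div_le_one_div_of_le (by positivity) h16y
  have h168 : 1 / (8 * y) = 1 / (16 * y) + 1 / (16 * y) := by
    field_simp; norm_num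
  have hpos16 : 0 < 1 / (16 * y) := by positivity
  have hfin := h (by linarith)
  have hlogt : Real.log (√n) = l * (y ^ 4 * v) / 2 := by rw [Real.log_sqrt hn0.le, hlogn]
  have hmain : n * y ^ 3 / 400 ≤ r / 2 * (θ - 1 / n) * Real.log (√n) := by
    have h1 : 1 / (16 * y) ≤ θ - 1 / n := by linarith
    rw [hlogt]
    calc n * y ^ 3 / 400 ≤ (4 * (r * v)) * y ^ 3 / 400 := by gcongr
      _ = (r * v) * y ^ 3 * (64 / 100) / 64 := by ring
      _ ≤ (r * v) * y ^ 3 * l / 64 := by gcongr; linarith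
      _ = r / 2 * (1 / (16 * y)) * (l * (y ^ 4 * v) / 2) := by field_simp; ring
      _ ≤ _ := by gcongr
  have hsub : (√n - 1) * r * (2 / n) ≤ n := by
    have h1 : √n ≤ n := (Real.sqrt_le_left hn0.le).2 (by nlinarith only [hn])
    rw [mul_div_assoc', div_le_iff₀ hn0]
    calc (√n - 1) * r * 2 = (√n - 1) * (r * 2) := by ring
      _ ≤ n * n := by gcongr; linarith
  have hcontra : n * (y ^ 3 / 400) ≤ n * (y / 3 + 3) := by
    have : 0 ≤ n * y := by positivity
    linarith
  have h9 := le_of_mul_le_mul_left hcontra hn0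
  have h10 : 1024 * y ≤ y ^ 3 := by
    have : (1024 : ℝ) ≤ y ^ 2 := (by norm_num : (1024 : ℝ) ≤ 32 ^ 2).trans (by gcongr)
    calc 1024 * y ≤ y ^ 2 * y := by gcongr
      _ = y ^ 3 := by ring
  linarith

/-! ### Lower bounds on the expected size -/

section Bounds

variable {U : Type*} [Fintype U] [DecidableEq U] {n v : ℕ} {Ω : Type*} [MeasurableSpace Ω]
  {P : Measure Ω} [IsProbabilityMeasure P] (D : IncrementalRetrieval U n v P)

/-- The redundancy is at least linear, for values of every length. -/
theorem linear_redundancy_le_expectedSize (hn : 1000 ≤ n) (hv : 1 ≤ v)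
    (hU : n ^ 3 ≤ Fintype.card U) :
    ENNReal.ofReal ((n : ℝ) * v + n / 100) ≤ D.expectedSize := by
  by_contra! hS
  obtain ⟨r, p, hpr, hr, hrp⟩ : ∃ r p : ℕ, p + r = n ∧ r = n / 2 ∧ r ≤ p :=
    ⟨n / 2, n - n / 2, by omega, rfl, by omega⟩
  have hr0 : 0 < r := by omega
  have hp0 : 0 < p := by omega
  obtain ⟨φ⟩ := exists_point_embedding (U := U) (p := p) (r := r) (s := n) (by
    refine le_trans ?_ hU
    rw [pow_succ, pow_two, mul_assoc]
    gcongr <;> omega)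
  obtain ⟨A, B, hAB, hA, hB, h⟩ := exists_update_tradeoff D hp0 hr0 (by omega) hv hpr φ
    (by positivity) hS (t := 2) (by norm_num)
  have hl := Real.log_two_gt_d9
  have hl' := Real.log_two_lt_d9
  set l := Real.log 2
  set E₀ := 2 * l * (A - n * v) + 4 with hE₀
  set E₁ := 2 * l * (B - n * v) + 4 with hE₁
  have hn' : (1000 : ℝ) ≤ n := by exact_mod_cast hn
  have hE₀0 : 0 ≤ E₀ := by nlinarith
  have hE₁0 : 0 ≤ E₁ := by nlinarith
  have hsum : E₀ + E₁ ≤ l * n / 25 + 8 := by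
    have : 2 * l * (A + B) ≤ 2 * l * (2 * (n * v + n / 100)) := by gcongr
    rw [hE₀, hE₁]
    linarith
  have hp' : (0 : ℝ) < p := by exact_mod_cast hp0
  have hrp' : (r : ℝ) ≤ p := by exact_mod_cast hrp
  have h1 : (r : ℝ) * ((E₀ + l) / p) ≤ E₀ + l := by
    rw [mul_div_assoc', div_le_iff₀ hp', mul_comm]
    gcongr
  have h2 : (n : ℝ) ≤ 2 * r + 1 := by exact_mod_cast (by omega : n ≤ 2 * r + 1)
  have h3 : (r : ℝ) / 2 * l ≤ (2 * n / 25 + 27) * l := by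
    have : (2 - 1 : ℝ) * r * ((E₀ + l) / p) = r * ((E₀ + l) / p) := by ring
    rw [this] at h
    linarith
  have h4 := le_of_mul_le_mul_right h3 (by linarith)
  linarith

/-- If values are short compared with `log₂ n`, the redundancy is of order `n log (log₂ n / v)`. -/
theorem log_redundancy_le_expectedSize (hn : 1000 ≤ n) (hv : 1 ≤ v)
    (hU : n ^ 3 ≤ Fintype.card U) {L : ℝ} (hL : L = Real.logb 2 n / v) (hL20 : 2 ^ 20 ≤ L) :
    ENNReal.ofReal ((n : ℝ) * v + n * Real.logb 2 L / 50) ≤ D.expectedSize := by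
  by_contra! hS
  have hn' : (1000 : ℝ) ≤ n := by exact_mod_cast hn
  have hv' : (1 : ℝ) ≤ v := by exact_mod_cast hv
  have hL0 : 0 < L := lt_of_lt_of_le (by norm_num) hL20
  obtain ⟨y, hy, hyL⟩ := exists_fourth_root hL20
  have hlogn : Real.log n = Real.log 2 * (y ^ 4 * v) := by
    rw [hyL, hL, Real.logb]
    field_simp
  have hyvn : y ^ 4 * v ≤ n := le_of_log_eq (by linarith) hlogn
  have hvn' : 4 * v ≤ n := by
    have h4 : (4 : ℝ) ≤ y ^ 4 := by rw [hyL]; exact le_trans (by norm_num) hL20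
    exact_mod_cast (mul_le_mul_of_nonneg_right h4 (by linarith : (0 : ℝ) ≤ v)).trans hyvn
  -- At most `n / 2` bits are spared before the second batch of insertions.
  obtain ⟨r, p, hpr, hr⟩ : ∃ r p : ℕ, p + r = n ∧ r = n / (2 * v) :=
    ⟨n / (2 * v), n - n / (2 * v), Nat.sub_add_cancel (Nat.div_le_self _ _), rfl⟩
  have hrv : r * (2 * v) ≤ n := by rw [hr]; exact Nat.div_mul_le_self _ _
  have hrv' : n < (2 * v) * (r + 1) := by rw [hr]; exact Nat.lt_mul_div_succ n (by omega)
  have hr0 : 0 < r := by rw [hr]; exact Nat.div_pos (by omega) (by omega)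
  have hrn : r * 2 ≤ n := (Nat.mul_le_mul_left r (by omega)).trans hrv
  have hrvR : (r : ℝ) * (2 * v) ≤ n := by exact_mod_cast hrv
  have hrvR' : (n : ℝ) ≤ (2 * v) * (r + 1) := by exact_mod_cast hrv'.le
  have hvnR : (4 : ℝ) * v ≤ n := by exact_mod_cast hvn'
  have hrnR : (r : ℝ) * 2 ≤ n := by exact_mod_cast hrn
  have hpR : (p : ℝ) + r = n := by exact_mod_cast hpr
  obtain ⟨φ⟩ := exists_point_embedding (U := U) (p := p) (r := r) (s := n) (by
    refine le_trans ?_ hU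
    rw [pow_succ, pow_two, mul_assoc]
    gcongr <;> omega)
  have hlogb0 : 0 ≤ Real.logb 2 L :=
    Real.logb_nonneg (by norm_num) (le_trans (by norm_num) hL20)
  obtain ⟨A, B, hAB, hA, hB, h⟩ := exists_insertion_tradeoff D (by omega) hr0 (by omega) hv hpr φ
    (by positivity) hS (t := √n) (Real.one_le_sqrt.2 (by linarith))
  refine not_insertion_tradeoff hn' hv' hy hyvn hlogn (Nat.cast_nonneg r) hrnR hpR (by linarith)
    (by linarith) ?_ hAB hA hB h
  rw [← hyL, Real.logb, Real.log_pow]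
  norm_num

end Bounds

end Retrieval

theorem theorem2 :
    ∃ c : ℝ, 0 < c ∧ ∃ n₀ : ℕ, ∀ (n v : ℕ), n₀ ≤ n → 1 ≤ v →
      ∀ (U : Type*) [Fintype U] [DecidableEq U], n ^ 3 ≤ Fintype.card U →
      ∀ (Ω : Type*) [MeasurableSpace Ω] (P : Measure Ω) [IsProbabilityMeasure P]
        (D : Retrieval.IncrementalRetrieval U n v P),
        ENNReal.ofReal ((n : ℝ) * v + c * n
            + c * (n * max (Real.logb 2 (Real.logb 2 n / v)) 0))
          ≤ D.expectedSize := by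
  refine ⟨1 / 2100, by norm_num, 1000, ?_⟩
  intro n v hn hv U _ _ hU Ω _ P _ D
  have hn0 : (0 : ℝ) ≤ n := Nat.cast_nonneg n
  -- Below the threshold the logarithm is at most `20`, and the linear bound absorbs it.
  by_cases hL : (2 : ℝ) ^ 20 ≤ Real.logb 2 n / v
  · refine le_trans (ENNReal.ofReal_le_ofReal ?_)
      (Retrieval.log_redundancy_le_expectedSize D hn hv hU rfl hL)
    have h1 : 1 ≤ Real.logb 2 (Real.logb 2 n / v) := by
      rw [Real.le_logb_iff_rpow_le (by norm_num) (by linarith)]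
      norm_num at hL ⊢
      linarith
    rw [max_eq_left (by linarith)]
    nlinarith
  · refine le_trans (ENNReal.ofReal_le_ofReal ?_)
      (Retrieval.linear_redundancy_le_expectedSize D hn hv hU)
    push Not at hL
    have h1 : max (Real.logb 2 (Real.logb 2 n / v)) 0 ≤ 20 := by
      refine max_le ?_ (by norm_num)
      have h0 : 0 ≤ Real.logb 2 n / v :=
        div_nonneg (Real.logb_nonneg (by norm_num) (by exact_mod_cast (by omega : 1 ≤ n)))
          (Nat.cast_nonneg v)
      rcases h0.eq_or_lt with h0 | h0
      · rw [← h0]; simp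
      · rw [Real.logb_le_iff_le_rpow (by norm_num) h0]
        norm_num at hL ⊢
        exact hL.le
    nlinarith
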